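/- **Setting.** For finite-dimensional Euclidean spaces $E,F$ of dimensions $p,m\ge 1$ and $k\ge 1$, a map $\Phi:E\to F$ is *pseudo-Lipschitz of order $k$* if there is a constant $L$ with $$\frac{\|\Phi(x)-\Phi(y)\|_2}{\sqrt m}\le L\Big(1+\big(\tfrac{\|x\|_2}{\sqrt p}\big)^{k-1}+\big(\tfrac{\|y\|_2}{\sqrt p}\big)^{k-1}\Big)\frac{\|x-y\|_2}{\sqrt p}\qquad\text{for all }x,y\in E .$$ A real random variable $X$ is *subgaussian* if $\mathbb E[\exp(X^2/K^2)]\le 2$ for some $K>0$ (it need not be centred). Let $f:\mathbb R\to\mathbb R$ be twice differentiable, and for $n\ge1$ let $\mathbf f(x)=\sum_{i=1}^n f(x_i)$ on $\mathbb R^n$ be the associated separable loss. Assume that, for some $k\ge 1$, the gradient $\nabla\mathbf f:\mathbb R^n\to\mathbb R^n$ is pseudo-Lipschitz of order $k$ for every $n\ge1$ (the constant may depend on $n$). Let $(\gamma^t)_{t\in\mathbb N}$ be real step sizes and let $n,d\to\infty$ with $n/d\to\alpha\in(0,\infty)$. For each pair $(n,d)$ let $\mathbf w^0\in\mathbb R^d$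 have i.i.d. entries distributed as a fixed subgaussian random variable $\omega^0$, and let $\mathbf A^0,\mathbf A^1,\dots\in\mathbb R^{n\times d}$ be independent random matrices, independent of $\mathbf w^0$, each with i.i.d. $\mathcal N(0,1/d)$ entries. Define $$\mathbf w^{t+1}=\mathbf w^t-\gamma^t(\mathbf A^t)^\top\nabla\mathbf f(\mathbf A^t\mathbf w^t),\qquad t\in\mathbb N .$$ **Scalar process.** Starting from $\omega^0$, define $$\omega^{t+1}=\big(1-\gamma^t\alpha\,\mathbb E[f''(z^t)]\big)\,\omega^t+\gamma^t u^t,\qquad t\in\mathbb N,$$ where $z^t\sim\mathcal N(0,\rho^t)$ with $\rho^t=\mathbb E[(\omega^t)^2]$, and $u^t\sim\mathcal N(0,\tau^t)$ with $\tau^t=\alpha\,\mathbb E[f'(z^t)^2]$ is independent of $\omega^t$. **Theorem (High-dimensional dynamics of gradient descent with sample splitting).** For every $t\in\mathbb N$ and every $\psi:\mathbb R\to\mathbb R$ that is pseudo-Lipschitz of order $2$, $\psi(\omega^t)$ is integrable and $$\frac1d\sum_{i=1}^d\psi(w^t_i)\;\longrightarrow\;\mathbb E[\psi(\omega^t)]\qquad\text{in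 probability as } n,d\to\infty .$$ -/

import Mathlib

open MeasureTheory ProbabilityTheory Filter Topology

noncomputable section

/-- `Φ : E → F` is pseudo-Lipschitz of order `k`, with the norms normalised by the square roots of
the dimensions of `E` and `F` (for `E = F = ℝ` these factors are `1`). -/
def IsPseudoLipschitz {E F : Type*} [NormedAddCommGroup E] [NormedSpace ℝ E]
    [NormedAddCommGroup F] [NormedSpace ℝ F] (k : ℕ) (Φ : E → F) : Prop :=
  ∃ L : ℝ, ∀ x y : E,
    ‖Φ x - Φ y‖ / √(Module.finrank ℝ F : ℝ) ≤
      L * (1 + (‖x‖ / √(Module.finrank ℝ E : ℝ)) ^ (k - 1)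
             + (‖y‖ / √(Module.finrank ℝ E : ℝ)) ^ (k - 1))
        * (‖x - y‖ / √(Module.finrank ℝ E : ℝ))

/-- A real random variable is subgaussian if it has finite `ψ₂`-norm:
`𝔼 exp (X² / K²) ≤ 2` for some `K > 0`. No centring is required. -/
def IsSubgaussian {Ω : Type*} [MeasurableSpace Ω] (X : Ω → ℝ) (P : Measure Ω) : Prop :=
  ∃ K : ℝ, 0 < K ∧ ∫⁻ s, ENNReal.ofReal (Real.exp (X s ^ 2 / K ^ 2)) ∂P ≤ 2

/-- The separable loss `x ↦ ∑ i, f (x i)` on `ℝⁿ`. -/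
def separableLoss (f : ℝ → ℝ) (n : ℕ) (x : EuclideanSpace ℝ (Fin n)) : ℝ :=
  ∑ i, f (x i)

/-- Gradient descent with a fresh data matrix at each step:
`w^{t+1} = w^t - γ^t (A^t)ᵀ ∇F (A^t w^t)`. -/
def gdIterate {n d : ℕ} (F : EuclideanSpace ℝ (Fin n) → ℝ) (γ : ℕ → ℝ)
    (A : ℕ → Matrix (Fin n) (Fin d) ℝ) (w₀ : EuclideanSpace ℝ (Fin d)) :
    ℕ → EuclideanSpace ℝ (Fin d)
  | 0 => w₀
  | t + 1 =>
      gdIterate F γ A w₀ t -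
        γ t • Matrix.toEuclideanLin (A t).transpose
          (gradient F (Matrix.toEuclideanLin (A t) (gdIterate F γ A w₀ t)))

/-- `ω` is the scalar stochastic process
`ω^{t+1} = (1 - γ^t α 𝔼[f''(z^t)]) ω^t + γ^t u^t`, where `z^t ∼ N(0, 𝔼[(ω^t)²])` and
`u^t ∼ N(0, α 𝔼[f'(z^t)²])` is independent of `ω^t`. The variables `z^t` enter only through
their laws. -/
structure IsScalarProcess {Ω : Type*} [MeasurableSpace Ω] (Q : Measure Ω)
    (f : ℝ → ℝ) (α : ℝ) (γ : ℕ → ℝ) (ω z u : ℕ → Ω → ℝ) : Prop where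
  law_z : ∀ t, HasLaw (z t) (gaussianReal 0 (∫ s, ω t s ^ 2 ∂Q).toNNReal) Q
  law_u : ∀ t, HasLaw (u t) (gaussianReal 0 (α * ∫ s, deriv f (z t s) ^ 2 ∂Q).toNNReal) Q
  indep : ∀ t, IndepFun (ω t) (u t) Q
  step : ∀ t s,
    ω (t + 1) s = (1 - γ t * α * ∫ s', deriv (deriv f) (z t s') ∂Q) * ω t s + γ t * u t s

/-- Convergence in probability to a constant, for real random variables `X N` that may live on
different probability spaces. -/
def TendstoInProbability {Ω : ℕ → Type*} [∀ N, MeasurableSpace (Ω N)]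
    (P : ∀ N, Measure (Ω N)) (X : ∀ N, Ω N → ℝ) (c : ℝ) : Prop :=
  ∀ ε : ℝ, 0 < ε → Tendsto (fun N => P N {s | ε ≤ |X N s - c|}) atTop (𝓝 0)

end

/-!
Conditionally on the current iterate `w`, the fresh Gaussian matrix `A` splits into its component
along `w` and an independent remainder. If `e = w / ‖w‖`, the rows of `√d • A` have the joint law of
`g j • e + P b j`, where `P` is the projection to the orthogonal complement of `e` and the `g j`,
`b j` are independent standard Gaussians (for `w = 0` take `e = 0` and `P = 1`). The vector of
gradients `h j = f' (‖w‖ g j / √d)` depends on `g` only, so `∑ h j b j` is `‖h‖ ξ` in law with `ξ`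
standard Gaussian and independent of `g`, and the next iterate has the law of
`w - γ / √d * ((∑ h j g j) • e + ‖h‖ • P ξ)` (`map_rowStep`).

By the law of large numbers, `‖w‖ / √d → √ρ`, `‖h‖² / d → α 𝔼[f'(z)²] = τ`, and
`(∑ h j g j) / d → α 𝔼[f'(√ρ g) g] = α √ρ 𝔼[f''(z)]`, the last equality being Stein's identity.
Hence the next iterate is at normalised distance `o(1)` from `(1 - γ α 𝔼[f''(z)]) w - γ √τ ξ`
(`tendsto_decoupledStep_sub`), whose empirical distribution is, by Chebyshev's inequality
conditionally on `w`, close to that of the rescaled `w` convolved with a Gaussian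
(`tendsto_empAvg_add_noise`). This is the scalar recursion, up to the sign of the noise. The theorem
follows by induction on `t` (`EmpiricalLawTendsto.step`), since `w^t` is independent of `A^t`
(`indepFun_gdIterate_scaledRows`).

The conditional law of large numbers is only needed for bounded Lipschitz test functions and for the
square: these determine the limits for all pseudo-Lipschitz functions of order `2`, by truncation
(`tendsto_empAvg_of_bounded_lipschitz`). So second moments of the iterates suffice in the induction.

Convergence in probability along varying probability spaces is encoded as convergence along a filter
(`probFilter`), so that limits can be combined by the usual rules.
-/

open scoped RealInnerProductSpace

/-! ### Convergence in probability as convergence along a filter -/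

/-- The filter on the disjoint union of the spaces `Ω N` whose members are the sets `S` with
`P N {s | (N, s) ∉ S} → 0`. Convergence in probability is convergence along this filter, so that
limit theorems for filters apply to it. -/
def probFilter {Ω : ℕ → Type*} [∀ N, MeasurableSpace (Ω N)] (P : ∀ N, Measure (Ω N)) :
    Filter (Σ N, Ω N) where
  sets := {S | Tendsto (fun N => P N {s | (⟨N, s⟩ : Σ N, Ω N) ∉ S}) atTop (𝓝 0)}
  univ_sets := by simp
  sets_of_superset := by
    intro S T hS hST
    exact tendsto_of_tendsto_of_tendsto_of_le_of_le tendsto_const_nhds hS (fun _ => zero_le)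
      (fun N => measure_mono fun s hs h => hs (hST h))
  inter_sets := by
    intro S T hS hT
    have h := Tendsto.add hS hT
    rw [add_zero] at h
    refine tendsto_of_tendsto_of_tendsto_of_le_of_le tendsto_const_nhds h (fun _ => zero_le)
      (fun N => (measure_mono ?_).trans (measure_union_le _ _))
    intro s hs
    by_cases h1 : (⟨N, s⟩ : Σ N, Ω N) ∈ S
    · exact Or.inr fun h2 => hs ⟨h1, h2⟩
    · exact Or.inl h1

section ProbFilter

variable {Ω Ω' : ℕ → Type*} [∀ N, MeasurableSpace (Ω N)] [∀ N, MeasurableSpace (Ω' N)]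
  {P : ∀ N, Measure (Ω N)}

theorem mem_probFilter {S : Set (Σ N, Ω N)} :
    S ∈ probFilter P ↔ Tendsto (fun N => P N {s | (⟨N, s⟩ : Σ N, Ω N) ∉ S}) atTop (𝓝 0) :=
  Iff.rfl

theorem tendstoInProbability_iff {X : ∀ N, Ω N → ℝ} {c : ℝ} :
    TendstoInProbability P X c ↔
      Tendsto (fun p : Σ N, Ω N => X p.1 p.2) (probFilter P) (𝓝 c) := by
  rw [Metric.tendsto_nhds]
  refine forall_congr' fun ε => forall_congr' fun _ => ?_
  rw [Filter.Eventually, mem_probFilter]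
  simp [Real.dist_eq]

theorem tendsto_fst_probFilter : Tendsto (fun p : Σ N, Ω N => p.1) (probFilter P) atTop := by
  intro S hS
  rw [mem_map, mem_probFilter]
  refine tendsto_const_nhds.congr' ?_
  filter_upwards [hS] with N hN
  simp [hN]

theorem tendsto_probFilter_map {T : ∀ N, Ω N → Ω' N} (hT : ∀ N, AEMeasurable (T N) (P N)) :
    Tendsto (fun p : Σ N, Ω N => (⟨p.1, T p.1 p.2⟩ : Σ N, Ω' N)) (probFilter P)
      (probFilter fun N => (P N).map (T N)) := by
  intro S hS
  exact tendsto_of_tendsto_of_tendsto_of_le_of_le tendsto_const_nhds hS (fun _ => zero_le)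
    (fun N => Measure.le_map_apply (hT N) _)

theorem tendsto_probFilter_measurePreserving {Q : ∀ N, Measure (Ω' N)} {T : ∀ N, Ω N → Ω' N}
    (hT : ∀ N, MeasurePreserving (T N) (P N) (Q N)) :
    Tendsto (fun p : Σ N, Ω N => (⟨p.1, T p.1 p.2⟩ : Σ N, Ω' N)) (probFilter P)
      (probFilter Q) := by
  have := tendsto_probFilter_map (P := P) (T := T) fun N => (hT N).aemeasurable
  simpa only [(hT _).map_eq] using this

/-- Convergence in probability of a measurable function depends only on the laws. -/
theorem tendsto_probFilter_map_iff {T : ∀ N, Ω N → Ω' N} (hT : ∀ N, AEMeasurable (T N) (P N))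
    {X : ∀ N, Ω' N → ℝ} (hX : ∀ N, Measurable (X N)) {c : ℝ} :
    Tendsto (fun p : Σ N, Ω' N => X p.1 p.2) (probFilter fun N => (P N).map (T N)) (𝓝 c) ↔
      Tendsto (fun p : Σ N, Ω N => X p.1 (T p.1 p.2)) (probFilter P) (𝓝 c) := by
  rw [← tendstoInProbability_iff, ← tendstoInProbability_iff (X := fun N s => X N (T N s))]
  refine forall_congr' fun ε => forall_congr' fun _ => ?_
  refine tendsto_congr fun N => ?_
  rw [Measure.map_apply_of_aemeasurable (hT N)]
  · rfl
  · exact measurableSet_le measurable_const ((hX N).sub_const c).abs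

/-- If the conditional probability, given the first component, of a deviation from `c` is bounded
by a quantity tending to `0` which does not depend on this component, then there is convergence in
probability. -/
theorem tendsto_probFilter_prod_of_fiberwise {μ : ∀ N, Measure (Ω' N)}
    [∀ N, IsProbabilityMeasure (P N)] [∀ N, IsProbabilityMeasure (μ N)]
    {X : ∀ N, Ω N × Ω' N → ℝ} (hX : ∀ N, Measurable (X N)) {c : ℝ}
    (h : ∀ ε : ℝ, 0 < ε → ∃ b : ℕ → ENNReal, Tendsto b atTop (𝓝 0) ∧
      ∀ N x, μ N {y | ε ≤ |X N (x, y) - c|} ≤ b N) :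
    Tendsto (fun p : Σ N, Ω N × Ω' N => X p.1 p.2) (probFilter fun N => (P N).prod (μ N))
      (𝓝 c) := by
  rw [← tendstoInProbability_iff]
  intro ε hε
  obtain ⟨b, hb, hle⟩ := h ε hε
  refine tendsto_of_tendsto_of_tendsto_of_le_of_le tendsto_const_nhds hb (fun _ => zero_le)
    fun N => ?_
  rw [Measure.prod_apply (measurableSet_le measurable_const ((hX N).sub_const c).abs)]
  calc ∫⁻ x, μ N (Prod.mk x ⁻¹' {s | ε ≤ |X N s - c|}) ∂(P N)
      ≤ ∫⁻ _, b N ∂(P N) := lintegral_mono fun x => hle N x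
    _ = b N := by simp

end ProbFilter

/-! ### Pseudo-Lipschitz functions and empirical averages -/

theorem isPseudoLipschitz_two_iff {ψ : ℝ → ℝ} : IsPseudoLipschitz 2 ψ ↔
    ∃ L : ℝ, ∀ x y, |ψ x - ψ y| ≤ L * (1 + |x| + |y|) * |x - y| := by
  simp [IsPseudoLipschitz]

theorem LipschitzWith.isPseudoLipschitz_two {K : NNReal} {ψ : ℝ → ℝ} (h : LipschitzWith K ψ) :
    IsPseudoLipschitz 2 ψ := by
  refine isPseudoLipschitz_two_iff.2 ⟨K, fun x y => ?_⟩
  have h1 := h.dist_le_mul x y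
  rw [Real.dist_eq, Real.dist_eq] at h1
  refine h1.trans (mul_le_mul_of_nonneg_right ?_ (abs_nonneg _))
  nlinarith [abs_nonneg x, abs_nonneg y, K.2, mul_nonneg K.2 (abs_nonneg x),
    mul_nonneg K.2 (abs_nonneg y)]

theorem isPseudoLipschitz_two_sq : IsPseudoLipschitz 2 (fun x : ℝ => x ^ 2) := by
  refine isPseudoLipschitz_two_iff.2 ⟨1, fun x y => ?_⟩
  have : x ^ 2 - y ^ 2 = (x + y) * (x - y) := by ring
  rw [this, abs_mul]
  refine mul_le_mul_of_nonneg_right ?_ (abs_nonneg _)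
  linarith [abs_add_le x y]

/-- Truncation to `[-M, M]`. -/
def clamp (M x : ℝ) : ℝ := max (-M) (min x M)

theorem lipschitzWith_clamp (M : ℝ) : LipschitzWith 1 (clamp M) :=
  (LipschitzWith.id.min_const M).const_max (-M)

theorem abs_clamp_le {M : ℝ} (hM : 0 ≤ M) (x : ℝ) : |clamp M x| ≤ M := by
  rw [abs_le]
  exact ⟨le_max_left _ _, max_le (by linarith) (min_le_right _ _)⟩

theorem clamp_of_abs_le {M x : ℝ} (h : |x| ≤ M) : clamp M x = x := by
  rw [abs_le] at h
  rw [clamp, min_eq_left h.2, max_eq_right h.1]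

theorem sq_clamp_le {M : ℝ} (hM : 0 ≤ M) (x : ℝ) : clamp M x ^ 2 ≤ x ^ 2 := by
  by_cases h : |x| ≤ M
  · rw [clamp_of_abs_le h]
  · exact sq_le_sq.2 ((abs_clamp_le hM x).trans (not_le.1 h).le)

/-- The truncation error of a pseudo-Lipschitz function is controlled by that of the square. -/
theorem abs_sub_comp_clamp_le {ψ : ℝ → ℝ} {L M : ℝ} (hL : 0 ≤ L) (hM : 1 ≤ M)
    (h : ∀ x y, |ψ x - ψ y| ≤ L * (1 + |x| + |y|) * |x - y|) (x : ℝ) :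
    |ψ x - ψ (clamp M x)| ≤ 3 * L * (x ^ 2 - clamp M x ^ 2) := by
  by_cases hx : |x| ≤ M
  · simp [clamp_of_abs_le hx]
  refine (h _ _).trans ?_
  rw [mul_comm 3 L, mul_assoc, mul_assoc]
  refine mul_le_mul_of_nonneg_left ?_ hL
  rw [not_le] at hx
  rcases lt_abs.1 hx with hx | hx
  · have hc : clamp M x = M := by rw [clamp, min_eq_right hx.le, max_eq_right (by linarith)]
    rw [hc, abs_of_pos (by linarith : 0 < x), abs_of_pos (by linarith : 0 < M),
      abs_of_pos (by linarith : 0 < x - M)]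
    nlinarith
  · have hc : clamp M x = -M := by
      rw [clamp, min_eq_left (by linarith), max_eq_left (by linarith)]
    rw [hc, abs_of_neg (by linarith : x < 0), abs_neg, abs_of_pos (by linarith : 0 < M),
      abs_of_neg (by linarith : x - -M < 0)]
    nlinarith

theorem lipschitzWith_comp_clamp {ψ : ℝ → ℝ} {L M : ℝ} (hL : 0 ≤ L) (hM : 0 ≤ M)
    (h : ∀ x y, |ψ x - ψ y| ≤ L * (1 + |x| + |y|) * |x - y|) :
    LipschitzWith (L * (1 + M + M)).toNNReal (fun x => ψ (clamp M x)) := by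
  refine LipschitzWith.of_dist_le_mul fun x y => ?_
  rw [Real.dist_eq, Real.coe_toNNReal _ (by positivity)]
  have h2 := (lipschitzWith_clamp M).dist_le_mul x y
  rw [NNReal.coe_one, one_mul, Real.dist_eq] at h2
  refine (h _ _).trans ?_
  gcongr
  · exact abs_clamp_le hM x
  · exact abs_clamp_le hM y

theorem isPseudoLipschitz_two_bound {ψ : ℝ → ℝ} {L : ℝ} (hL : 0 ≤ L)
    (h : ∀ x y, |ψ x - ψ y| ≤ L * (1 + |x| + |y|) * |x - y|) (x : ℝ) :
    |ψ x| ≤ |ψ 0| + 2 * L * (1 + x ^ 2) := by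
  have h1 := h x 0
  simp only [abs_zero, add_zero, sub_zero] at h1
  have h2 : |ψ x| ≤ |ψ 0| + |ψ x - ψ 0| := by
    have := abs_add_le (ψ 0) (ψ x - ψ 0)
    rwa [add_sub_cancel] at this
  have h3 : L * (1 + |x|) * |x| ≤ 2 * L * (1 + x ^ 2) := by
    rw [mul_assoc, mul_comm 2 L, mul_assoc]
    refine mul_le_mul_of_nonneg_left ?_ hL
    nlinarith [sq_abs x, abs_nonneg x, sq_nonneg (|x| - 1)]
  linarith

theorem IsPseudoLipschitz.exists_nonneg {ψ : ℝ → ℝ} (h : IsPseudoLipschitz 2 ψ) :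
    ∃ L : ℝ, 0 ≤ L ∧ ∀ x y, |ψ x - ψ y| ≤ L * (1 + |x| + |y|) * |x - y| := by
  obtain ⟨L, hL⟩ := isPseudoLipschitz_two_iff.1 h
  refine ⟨|L|, abs_nonneg _, fun x y => (hL x y).trans ?_⟩
  have := le_abs_self L
  gcongr

theorem IsPseudoLipschitz.continuous {ψ : ℝ → ℝ} (h : IsPseudoLipschitz 2 ψ) :
    Continuous ψ := by
  obtain ⟨L, hL⟩ := isPseudoLipschitz_two_iff.1 h
  refine continuous_iff_continuousAt.2 fun x => tendsto_iff_dist_tendsto_zero.2 ?_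
  refine squeeze_zero (fun _ => dist_nonneg) (fun y => hL y x) ?_
  have : Continuous fun y : ℝ => L * (1 + |y| + |x|) * |y - x| := by fun_prop
  simpa using this.tendsto x

theorem IsPseudoLipschitz.integrable {ψ : ℝ → ℝ} (h : IsPseudoLipschitz 2 ψ) {μ : Measure ℝ}
    [IsFiniteMeasure μ] (hμ : Integrable (fun x => x ^ 2) μ) : Integrable ψ μ := by
  obtain ⟨L, hL0, hL⟩ := h.exists_nonneg
  refine Integrable.mono' (g := fun x => |ψ 0| + 2 * L * (1 + x ^ 2)) (by fun_prop)
    h.continuous.aestronglyMeasurable (ae_of_all _ fun x => ?_)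
  exact isPseudoLipschitz_two_bound hL0 hL x

/-- The empirical average of `ψ` over the entries of a vector; it vanishes in dimension `0`. -/
noncomputable def empAvg {d : ℕ} (ψ : ℝ → ℝ) (x : Fin d → ℝ) : ℝ := 1 / (d : ℝ) * ∑ i, ψ (x i)

theorem empAvg_sub {d : ℕ} (φ ψ : ℝ → ℝ) (x : Fin d → ℝ) :
    empAvg φ x - empAvg ψ x = empAvg (fun y => φ y - ψ y) x := by
  simp only [empAvg, Finset.sum_sub_distrib]
  ring

theorem empAvg_const_mul {d : ℕ} (c : ℝ) (ψ : ℝ → ℝ) (x : Fin d → ℝ) :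
    empAvg (fun y => c * ψ y) x = c * empAvg ψ x := by
  simp only [empAvg, ← Finset.mul_sum]
  ring

theorem empAvg_mono {d : ℕ} {φ ψ : ℝ → ℝ} (h : ∀ y, φ y ≤ ψ y) (x : Fin d → ℝ) :
    empAvg φ x ≤ empAvg ψ x :=
  mul_le_mul_of_nonneg_left (Finset.sum_le_sum fun i _ => h (x i)) (by positivity)

theorem abs_empAvg_le {d : ℕ} (ψ : ℝ → ℝ) (x : Fin d → ℝ) :
    |empAvg ψ x| ≤ empAvg (fun y => |ψ y|) x := by
  rw [empAvg, abs_mul, abs_of_nonneg (by positivity : (0 : ℝ) ≤ 1 / (d : ℝ))]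
  exact mul_le_mul_of_nonneg_left (Finset.abs_sum_le_sum_abs _ _) (by positivity)

theorem tendsto_integral_sq_sub_sq_clamp {μ : Measure ℝ} (hμ : Integrable (fun x => x ^ 2) μ) :
    Tendsto (fun M : ℕ => ∫ x, (x ^ 2 - clamp M x ^ 2) ∂μ) atTop (𝓝 0) := by
  have hc : ∀ M : ℝ, Continuous (clamp M) := fun M => (lipschitzWith_clamp M).continuous
  have : Tendsto (fun M : ℕ => ∫ x, (x ^ 2 - clamp M x ^ 2) ∂μ) atTop (𝓝 (∫ _, (0 : ℝ) ∂μ)) := by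
    refine tendsto_integral_of_dominated_convergence (fun x => x ^ 2)
      (fun M => ((continuous_pow 2).sub ((hc M).pow 2)).aestronglyMeasurable) hμ
      (fun M => ae_of_all _ fun x => ?_) (ae_of_all _ fun x => ?_)
    · have := sq_clamp_le (Nat.cast_nonneg M : (0 : ℝ) ≤ M) x
      rw [Real.norm_eq_abs, abs_of_nonneg (by linarith)]
      linarith [sq_nonneg (clamp M x)]
    · refine tendsto_const_nhds.congr' ?_
      filter_upwards [eventually_ge_atTop ⌈|x|⌉₊] with M hM
      rw [clamp_of_abs_le (Nat.ceil_le.1 hM), sub_self]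
  simpa using this

/-- Convergence of empirical averages of bounded Lipschitz functions and of the square implies
convergence for all pseudo-Lipschitz functions of order `2`: truncate the argument at level `M`;
the error is dominated by the truncation error of the square, which is small in the limit. -/
theorem tendsto_empAvg_of_bounded_lipschitz {ι : Type*} {F : Filter ι} {d : ι → ℕ}
    {x : ∀ i, Fin (d i) → ℝ} {μ : Measure ℝ} [IsProbabilityMeasure μ]
    (hμ : Integrable (fun x => x ^ 2) μ)
    (hsq : Tendsto (fun i => empAvg (fun y => y ^ 2) (x i)) F (𝓝 (∫ y, y ^ 2 ∂μ)))
    (hbl : ∀ (K : NNReal) (B : ℝ) (ψ : ℝ → ℝ), LipschitzWith K ψ → (∀ y, |ψ y| ≤ B) →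
      Tendsto (fun i => empAvg ψ (x i)) F (𝓝 (∫ y, ψ y ∂μ)))
    {ψ : ℝ → ℝ} (hψ : IsPseudoLipschitz 2 ψ) :
    Tendsto (fun i => empAvg ψ (x i)) F (𝓝 (∫ y, ψ y ∂μ)) := by
  obtain ⟨L, hL0, hL⟩ := hψ.exists_nonneg
  -- the truncation of a pseudo-Lipschitz function is an admissible test function
  have key : ∀ φ : ℝ → ℝ, IsPseudoLipschitz 2 φ → ∀ M : ℝ, 0 ≤ M →
      Tendsto (fun i => empAvg (fun y => φ (clamp M y)) (x i)) F
        (𝓝 (∫ y, φ (clamp M y) ∂μ)) ∧ Integrable (fun y => φ (clamp M y)) μ := by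
    intro φ hφ M hM
    obtain ⟨L', hL0', hL'⟩ := hφ.exists_nonneg
    have hl := lipschitzWith_comp_clamp hL0' hM hL'
    refine ⟨hbl _ (|φ 0| + 2 * L' * (1 + M ^ 2)) _ hl fun y => ?_,
      hl.isPseudoLipschitz_two.integrable hμ⟩
    refine (isPseudoLipschitz_two_bound hL0' hL' _).trans ?_
    have : clamp M y ^ 2 ≤ M ^ 2 := sq_le_sq.2 ((abs_clamp_le hM y).trans (le_abs_self M))
    gcongr
  rw [Metric.tendsto_nhds]
  intro ε hε
  have hlim := (tendsto_integral_sq_sub_sq_clamp hμ).const_mul (3 * L)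
  rw [mul_zero] at hlim
  obtain ⟨M, hMε, hM1⟩ := ((hlim.eventually (gt_mem_nhds (by positivity : 0 < ε / 4))).and
    (eventually_ge_atTop 1)).exists
  have hM1' : (1 : ℝ) ≤ M := by exact_mod_cast hM1
  have hM0 : (0 : ℝ) ≤ M := by linarith
  obtain ⟨hψt, hψi⟩ := key ψ hψ M hM0
  obtain ⟨hqt, hqi⟩ := key _ isPseudoLipschitz_two_sq M hM0
  have herr : Tendsto (fun i => 3 * L * empAvg (fun y => y ^ 2 - clamp M y ^ 2) (x i)) F
      (𝓝 (3 * L * ∫ y, (y ^ 2 - clamp M y ^ 2) ∂μ)) := by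
    rw [integral_sub hμ hqi]
    refine ((hsq.sub hqt).const_mul _).congr fun i => ?_
    rw [empAvg_sub]
  have hInt : |∫ y, ψ y ∂μ - ∫ y, ψ (clamp M y) ∂μ| < ε / 4 := by
    refine lt_of_le_of_lt ?_ hMε
    rw [← integral_sub (hψ.integrable hμ) hψi, ← integral_const_mul]
    refine (abs_integral_le_integral_abs).trans (integral_mono ?_ ?_ ?_)
    · exact ((hψ.integrable hμ).sub hψi).abs
    · exact (hμ.sub hqi).const_mul _
    · exact fun y => abs_sub_comp_clamp_le hL0 hM1' hL y
  filter_upwards [Metric.tendsto_nhds.1 hψt (ε / 4) (by positivity),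
    herr.eventually (gt_mem_nhds hMε)] with i h1 h2
  have h3 : |empAvg ψ (x i) - empAvg (fun y => ψ (clamp M y)) (x i)| < ε / 4 := by
    refine lt_of_le_of_lt ?_ h2
    rw [empAvg_sub, ← empAvg_const_mul]
    exact (abs_empAvg_le _ _).trans
      (empAvg_mono (fun y => abs_sub_comp_clamp_le hL0 hM1' hL y) _)
  rw [Real.dist_eq] at h1 ⊢
  rw [abs_lt] at *
  constructor <;> linarith [h1.1, h1.2, h3.1, h3.2, hInt.1, hInt.2]

/-! ### Conditional law of a Gaussian matrix along a vector -/

section GaussianLaws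

variable {E : Type*} [NormedAddCommGroup E] [InnerProductSpace ℝ E]

/-- Projection to the orthogonal complement of `e`, if `e` has norm `1`; the identity if `e = 0`. -/
noncomputable def deflate (e x : E) : E := x - ⟪e, x⟫ • e

/-- The direction of `w`; it is `0` if `w = 0`. -/
noncomputable def direction (w : E) : E := ‖w‖⁻¹ • w

theorem direction_eq_zero_or_norm (w : E) : direction w = 0 ∨ ‖direction w‖ = 1 := by
  by_cases h : w = 0
  · left; simp [direction, h]
  · right; rw [direction, norm_smul, norm_inv, norm_norm, inv_mul_cancel₀ (norm_ne_zero_iff.2 h)]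

theorem norm_direction_le (w : E) : ‖direction w‖ ≤ 1 := by
  rcases direction_eq_zero_or_norm w with h | h <;> simp [h]

theorem norm_smul_direction (w : E) : ‖w‖ • direction w = w := by
  by_cases h : w = 0
  · simp [h]
  · rw [direction, smul_smul, mul_inv_cancel₀ (norm_ne_zero_iff.2 h), one_smul]

theorem inner_resample (w : E) (r : ℝ) (b : E) :
    ⟪r • direction w + deflate (direction w) b, w⟫ = ‖w‖ * r := by
  have hw : ⟪direction w, w⟫ = ‖w‖ := by
    by_cases h : w = 0
    · simp [h]
    · rw [direction, inner_smul_left, real_inner_self_eq_norm_sq, conj_trivial, pow_two,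
        ← mul_assoc, inv_mul_cancel₀ (norm_ne_zero_iff.2 h), one_mul]
  have h2 : ⟪b, w⟫ = ‖w‖ * ⟪direction w, b⟫ := by
    conv_lhs => rw [← norm_smul_direction w]
    rw [inner_smul_right, real_inner_comm]
  rw [deflate, inner_add_left, inner_sub_left, inner_smul_left, inner_smul_left, hw, h2]
  simp
  ring

variable [FiniteDimensional ℝ E] [MeasurableSpace E] [BorelSpace E]

/-- Two images of product measures agree as soon as they agree conditionally on the common first
component. -/
theorem map_prod_eq_of_fiberwise {X Y Y' Z : Type*} [MeasurableSpace X] [MeasurableSpace Y]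
    [MeasurableSpace Y'] [MeasurableSpace Z] (ν : Measure X) (μ : Measure Y) (μ' : Measure Y')
    [SFinite μ] [SFinite μ'] {T : X × Y → Z} {T' : X × Y' → Z}
    (hT : Measurable T) (hT' : Measurable T')
    (h : ∀ x, μ.map (fun y => T (x, y)) = μ'.map (fun y => T' (x, y))) :
    (ν.prod μ).map T = (ν.prod μ').map T' := by
  ext S hS
  rw [Measure.map_apply hT hS, Measure.map_apply hT' hS, Measure.prod_apply (hT hS),
    Measure.prod_apply (hT' hS)]
  refine lintegral_congr fun x => ?_
  have := congrArg (fun m => m S) (h x)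
  rw [Measure.map_apply (by fun_prop) hS, Measure.map_apply (by fun_prop) hS] at this
  exact this

theorem measurable_deflate : Measurable fun p : E × E => deflate p.1 p.2 := by
  unfold deflate; fun_prop

theorem measurable_deflate_right (e : E) : Measurable (deflate e) :=
  measurable_deflate.comp (measurable_const.prodMk measurable_id)

/-- A standard Gaussian vector may be resampled in the direction of `e`. For `e = 0` nothing is
resampled. -/
theorem map_resample_stdGaussian {e : E} (he : e = 0 ∨ ‖e‖ = 1) :
    ((gaussianReal 0 1).prod (stdGaussian E)).map (fun p => p.1 • e + deflate e p.2) =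
      stdGaussian E := by
  have hm : Measurable (deflate e) := measurable_deflate_right e
  have hd : Measurable fun r : ℝ => r • e := by fun_prop
  have h1 : ((gaussianReal 0 1).prod (stdGaussian E)).map (fun p => p.1 • e + deflate e p.2) =
      ((((gaussianReal 0 1).map (fun r : ℝ => r • e)).prod
        ((stdGaussian E).map (deflate e)))).map (fun p => p.1 + p.2) := by
    rw [Measure.map_prod_map _ _ hd hm, Measure.map_map (by fun_prop) (hd.prodMap hm)]
    rfl
  have := Measure.isProbabilityMeasure_map (μ := gaussianReal 0 1) hd.aemeasurable
  have := Measure.isProbabilityMeasure_map (μ := stdGaussian E) hm.aemeasurable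
  rw [h1]
  refine Measure.ext_of_charFun ?_
  rw [charFun_map_add_prod_eq_mul]
  ext t
  rw [Pi.mul_apply, charFun_apply, charFun_apply, integral_map hd.aemeasurable (by fun_prop),
    integral_map hm.aemeasurable (by fun_prop)]
  have e1 : ∀ x : E, ⟪deflate e x, t⟫ = ⟪x, deflate e t⟫ := by
    intro x
    simp only [deflate, inner_sub_left, inner_sub_right, inner_smul_left, inner_smul_right]
    simp only [conj_trivial, real_inner_comm x e]
    ring
  simp_rw [e1]
  rw [← charFun_apply, charFun_stdGaussian]
  simp_rw [inner_smul_left, conj_trivial, mul_comm _ ⟪e, t⟫]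
  have e2 := charFun_apply_real (μ := gaussianReal 0 1) ⟪e, t⟫
  simp only [Complex.ofReal_mul] at e2 ⊢
  rw [← e2, charFun_gaussianReal, ← Complex.exp_add, charFun_stdGaussian]
  congr 1
  have e3 : ‖deflate e t‖ ^ 2 = ‖t‖ ^ 2 - ⟪e, t⟫ ^ 2 := by
    rw [deflate, norm_sub_sq_real, inner_smul_right, norm_smul, real_inner_comm]
    rcases he with rfl | he
    · simp
    · rw [he]; simp; ring
  have e4 : (‖deflate e t‖ : ℂ) ^ 2 = (‖t‖ : ℂ) ^ 2 - (⟪e, t⟫ : ℂ) ^ 2 := by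
    exact_mod_cast congrArg (fun r : ℝ => (r : ℂ)) e3
  rw [e4]
  simp
  ring

/-- A linear combination of independent standard Gaussian vectors with coefficients `h j` is a
standard Gaussian vector times the Euclidean norm of `h`. -/
theorem map_sum_smul_stdGaussian {n : ℕ} (h : Fin n → ℝ) :
    (Measure.pi fun _ : Fin n => stdGaussian E).map (fun b => ∑ j, h j • b j) =
      (stdGaussian E).map (fun x => √(∑ j, h j ^ 2) • x) := by
  have hm : ∀ j, Measurable fun x : E => h j • x := fun j => by fun_prop
  have hp : ∀ j, IsProbabilityMeasure ((stdGaussian E).map fun x : E => h j • x) := fun j =>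
    Measure.isProbabilityMeasure_map (hm j).aemeasurable
  have h1 : (Measure.pi fun _ : Fin n => stdGaussian E).map (fun b => ∑ j, h j • b j) =
      (Measure.pi fun j : Fin n => (stdGaussian E).map fun x : E => h j • x).map
        (fun b => ∑ j, b j) := by
    rw [← Measure.pi_map_pi (fun j => (hm j).aemeasurable), Measure.map_map (by fun_prop)]
    · rfl
    · fun_prop
  rw [h1]
  refine Measure.ext_of_charFun ?_
  rw [charFun_map_sum_pi_eq_prod]
  ext t
  rw [Finset.prod_apply, charFun_map_smul, charFun_stdGaussian]
  simp_rw [charFun_map_smul, charFun_stdGaussian]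
  rw [← Complex.exp_sum]
  congr 1
  rw [norm_smul, Real.norm_of_nonneg (Real.sqrt_nonneg _)]
  simp_rw [norm_smul]
  have e1 : (√(∑ j, h j ^ 2) * ‖t‖) ^ 2 = ∑ j, (‖h j‖ * ‖t‖) ^ 2 := by
    rw [mul_pow, Real.sq_sqrt (by positivity), Finset.sum_mul]
    simp [mul_pow]
  rw [← Finset.sum_div, Finset.sum_neg_distrib]
  norm_cast
  rw [e1]

theorem measurable_direction : Measurable (direction : E → E) := by
  unfold direction; fun_prop

/-- One gradient step from `w` with the nonlinearity `φ`, as a function of the rows `a j` of the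
data matrix; `c` collects the step size and the normalisation of the matrix, `s` the
normalisation of the matrix inside `φ`. -/
noncomputable def rowStep {n : ℕ} (φ : ℝ → ℝ) (c s : ℝ) (w : E) (a : Fin n → E) : E :=
  w + c • ∑ j, φ (⟪a j, w⟫ * s) • a j

/-- The decoupled form of `rowStep`: the scalars `g j` are the components of the rows in the
direction of `w`, and `ξ` carries the remaining randomness. -/
noncomputable def decoupledStep {n : ℕ} (φ : ℝ → ℝ) (c s : ℝ) (w : E) (g : Fin n → ℝ) (ξ : E) :
    E :=
  w + c • ((∑ j, φ (‖w‖ * s * g j) * g j) • direction w +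
    √(∑ j, φ (‖w‖ * s * g j) ^ 2) • deflate (direction w) ξ)

theorem measurable_rowStep {n : ℕ} {φ : ℝ → ℝ} (hφ : Measurable φ) (c s : ℝ) :
    Measurable fun p : E × (Fin n → E) => rowStep φ c s p.1 p.2 := by
  unfold rowStep
  refine measurable_fst.add (Measurable.const_smul ?_ c)
  refine Finset.measurable_sum _ fun j _ => ?_
  exact (hφ.comp (by fun_prop)).smul (by fun_prop)

theorem measurable_decoupledStep {n : ℕ} {φ : ℝ → ℝ} (hφ : Measurable φ) (c s : ℝ) :
    Measurable fun p : E × ((Fin n → ℝ) × E) => decoupledStep φ c s p.1 p.2.1 p.2.2 := by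
  unfold decoupledStep
  have hd : Measurable fun p : E × ((Fin n → ℝ) × E) => direction p.1 :=
    measurable_direction.comp measurable_fst
  have hj : ∀ j, Measurable fun p : E × ((Fin n → ℝ) × E) => φ (‖p.1‖ * s * p.2.1 j) :=
    fun j => hφ.comp (by fun_prop)
  refine measurable_fst.add (Measurable.const_smul (Measurable.add ?_ ?_) c)
  · exact (Finset.measurable_sum _ fun j _ => (hj j).mul (by fun_prop)).smul hd
  · refine (Finset.measurable_sum _ fun j _ => (hj j).pow_const 2).sqrt.smul ?_
    exact measurable_deflate.comp (hd.prodMk (by fun_prop))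

/-- Given `w`, the gradient step with standard Gaussian rows has the law of its decoupled form:
the rows are resampled in the direction of `w`, which leaves the nonlinearities depending on the
`g j` only, and the linear combination of the rest is a Gaussian vector. -/
theorem map_rowStep {n : ℕ} {φ : ℝ → ℝ} (hφ : Measurable φ) (c s : ℝ) (w : E) :
    (Measure.pi fun _ : Fin n => stdGaussian E).map (rowStep φ c s w) =
      ((Measure.pi fun _ : Fin n => gaussianReal 0 1).prod (stdGaussian E)).map
        (fun p => decoupledStep φ c s w p.1 p.2) := by
  set R : ℝ × E → E := fun p => p.1 • direction w + deflate (direction w) p.2 with hR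
  have hRm : Measurable R :=
    (by fun_prop : Measurable fun p : ℝ × E => p.1 • direction w).add
      ((measurable_deflate_right _).comp measurable_snd)
  have hlaw : ((gaussianReal 0 1).prod (stdGaussian E)).map R = stdGaussian E :=
    map_resample_stdGaussian (direction_eq_zero_or_norm w)
  have hrow : Measurable (rowStep (n := n) φ c s w) :=
    (measurable_rowStep hφ c s).comp (measurable_const.prodMk measurable_id)
  have e1 : (Measure.pi fun _ : Fin n => stdGaussian E) =
      (Measure.pi fun _ : Fin n => (gaussianReal 0 1).prod (stdGaussian E)).map
        (fun x j => R (x j)) := by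
    rw [Measure.pi_map_pi (fun _ => hRm.aemeasurable), hlaw]
  have hmp := (measurePreserving_arrowProdEquivProdArrow ℝ E (Fin n) (fun _ => gaussianReal 0 1)
    (fun _ => stdGaussian E)).symm
  rw [e1, ← hmp.map_eq, Measure.map_map (by fun_prop) hmp.measurable,
    Measure.map_map hrow ((by fun_prop : Measurable fun (x : Fin n → ℝ × E) j => R (x j)).comp
      hmp.measurable)]
  refine map_prod_eq_of_fiberwise _ _ _ (hrow.comp ((by fun_prop :
      Measurable fun (x : Fin n → ℝ × E) j => R (x j)).comp hmp.measurable))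
    ((measurable_decoupledStep hφ c s).comp (by fun_prop :
      Measurable fun p : (Fin n → ℝ) × E => (w, p))) fun g => ?_
  set h : Fin n → ℝ := fun j => φ (‖w‖ * s * g j) with hh
  have e2 : (fun b : Fin n → E => (rowStep φ c s w ∘ (fun x j => R (x j)) ∘
      (MeasurableEquiv.arrowProdEquivProdArrow ℝ E (Fin n)).symm) (g, b)) =
      (fun x => w + c • ((∑ j, h j * g j) • direction w + deflate (direction w) x)) ∘
        (fun b => ∑ j, h j • b j) := by
    funext b
    have e3 : ∀ j, ((MeasurableEquiv.arrowProdEquivProdArrow ℝ E (Fin n)).symm (g, b)) j =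
      (g j, b j) := fun j => rfl
    simp only [Function.comp, e3, rowStep, hR, inner_resample]
    congr 2
    simp only [mul_right_comm _ _ s, smul_add, Finset.sum_add_distrib, Finset.sum_smul,
      smul_smul]
    congr 1
    simp only [deflate, smul_sub, Finset.sum_sub_distrib, inner_sum, inner_smul_right,
      Finset.sum_smul, smul_smul]
    rfl
  have e4 : (fun x : E => decoupledStep φ c s w g x) =
      (fun x => w + c • ((∑ j, h j * g j) • direction w + deflate (direction w) x)) ∘
        (fun x => √(∑ j, h j ^ 2) • x) := by
    funext x
    simp only [Function.comp, decoupledStep, deflate, smul_sub, inner_smul_right, smul_smul]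
    rfl
  have hmm : Measurable
      (fun x => w + c • ((∑ j, h j * g j) • direction w + deflate (direction w) x)) := by
    have : Measurable (deflate (direction w)) := measurable_deflate_right _
    fun_prop
  show Measure.map _ _ = Measure.map (fun x : E => decoupledStep φ c s w g x) _
  rw [e2, e4, ← Measure.map_map hmm (by fun_prop), ← Measure.map_map hmm (by fun_prop),
    map_sum_smul_stdGaussian]

end GaussianLaws

/-! ### Weak law of large numbers -/

/-- Chebyshev's inequality for a sum of functions of independent coordinates. -/
theorem measure_pi_deviation_le {n : ℕ} {μ : Measure ℝ} [IsProbabilityMeasure μ]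
    {φ : Fin n → ℝ → ℝ} (hφ : ∀ i, MemLp (φ i) 2 μ) {V : ℝ} (hV : ∑ i, Var[φ i; μ] ≤ V)
    {ε : ℝ} (hε : 0 < ε) :
    (Measure.pi fun _ : Fin n => μ) {x | ε ≤ |∑ i, φ i (x i) - ∑ i, ∫ y, φ i y ∂μ|} ≤
      ENNReal.ofReal (V / ε ^ 2) := by
  have hmem : ∀ i, MemLp (fun x : Fin n → ℝ => φ i (x i)) 2 (Measure.pi fun _ : Fin n => μ) :=
    fun i => (hφ i).comp_measurePreserving (measurePreserving_eval _ i)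
  have hint : ∫ x, (∑ i, fun x : Fin n → ℝ => φ i (x i)) x ∂(Measure.pi fun _ : Fin n => μ) =
      ∑ i, ∫ y, φ i y ∂μ := by
    simp only [Finset.sum_apply]
    rw [integral_finsetSum _ fun i _ => (hmem i).integrable one_le_two]
    exact Finset.sum_congr rfl fun i _ => integral_comp_eval (hφ i).aestronglyMeasurable
  have h := meas_ge_le_variance_div_sq (memLp_finsetSum' Finset.univ fun i _ => hmem i) hε
  rw [hint, variance_sum_pi hφ] at h
  simp only [Finset.sum_apply] at h
  refine h.trans (ENNReal.ofReal_le_ofReal ?_)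
  gcongr

theorem tendsto_ofReal_div_mul_atTop {m : ℕ → ℕ} (hm : Tendsto m atTop atTop) (V c : ℝ) :
    Tendsto (fun N => ENNReal.ofReal (V / (m N : ℝ) / c)) atTop (𝓝 0) := by
  have h : Tendsto (fun N => V / (m N : ℝ) / c) atTop (𝓝 0) := by
    have := ((tendsto_natCast_atTop_atTop (R := ℝ)).comp hm).const_div_atTop V
    simpa using this.div_const c
  simpa using ENNReal.tendsto_ofReal h

/-- The weak law of large numbers for triangular arrays of independent, identically distributed
variables. -/
theorem tendsto_empAvg_pi {m : ℕ → ℕ} (hm : Tendsto m atTop atTop) {μ : Measure ℝ}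
    [IsProbabilityMeasure μ] {φ : ℝ → ℝ} (hφ : MemLp φ 2 μ) :
    Tendsto (fun p : Σ N, (Fin (m N) → ℝ) => empAvg φ p.2)
      (probFilter fun N => Measure.pi fun _ : Fin (m N) => μ) (𝓝 (∫ y, φ y ∂μ)) := by
  refine (tendstoInProbability_iff (X := fun N (x : Fin (m N) → ℝ) => empAvg φ x)).1 ?_
  intro ε hε
  refine tendsto_of_tendsto_of_tendsto_of_le_of_le' tendsto_const_nhds
    (tendsto_ofReal_div_mul_atTop hm Var[φ; μ] (ε ^ 2)) (Eventually.of_forall fun _ => zero_le) ?_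
  filter_upwards [hm.eventually_ge_atTop 1] with N hN
  have hN0 : (m N : ℝ) ≠ 0 := by positivity
  have h := measure_pi_deviation_le (n := m N) (φ := fun _ y => 1 / (m N : ℝ) * φ y)
    (fun _ => hφ.const_mul _) (V := Var[φ; μ] / m N) (le_of_eq ?_) hε
  · have h1 : ∀ x : Fin (m N) → ℝ, ∑ i, 1 / (m N : ℝ) * φ (x i) = empAvg φ x :=
      fun x => (Finset.mul_sum _ _ _).symm
    have h2 : ∑ _i : Fin (m N), ∫ y, 1 / (m N : ℝ) * φ y ∂μ = ∫ y, φ y ∂μ := by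
      rw [integral_const_mul]
      simp
      field_simp
    simpa only [h1, h2] using h
  · simp only [variance_const_mul]
    simp
    field_simp

/-- Empirical averages of `Φ (s i)` with a random parameter `s i → σ` converge to the limit for the
parameter `σ`, if `Φ` is Lipschitz in the parameter with a constant that has bounded averages. -/
theorem tendsto_empAvg_parameter {ι : Type*} {F : Filter ι} {m : ι → ℕ}
    {g : ∀ i, Fin (m i) → ℝ} {s : ι → ℝ} {σ R : ℝ} (hs : Tendsto s F (𝓝 σ)) (hR : |σ| < R)
    {Φ : ℝ → ℝ → ℝ} {B : ℝ → ℝ} {b l : ℝ}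
    (hΦ : ∀ s, |s| ≤ R → ∀ x, |Φ s x - Φ σ x| ≤ |s - σ| * B x)
    (hB : Tendsto (fun i => empAvg B (g i)) F (𝓝 b))
    (hl : Tendsto (fun i => empAvg (Φ σ) (g i)) F (𝓝 l)) :
    Tendsto (fun i => empAvg (Φ (s i)) (g i)) F (𝓝 l) := by
  have h0 : Tendsto (fun i => |s i - σ| * empAvg B (g i)) F (𝓝 0) := by
    have := ((hs.sub_const σ).abs).mul hB
    simpa using this
  have h1 : Tendsto (fun i => empAvg (Φ (s i)) (g i) - empAvg (Φ σ) (g i)) F (𝓝 0) := by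
    refine squeeze_zero_norm' ?_ h0
    filter_upwards [hs.abs.eventually (ge_mem_nhds hR)] with i hi
    rw [Real.norm_eq_abs, empAvg_sub, ← empAvg_const_mul]
    exact (abs_empAvg_le _ _).trans (empAvg_mono (fun y => hΦ _ hi y) _)
  simpa using h1.add hl

/-! ### Polynomial growth and Gaussian integration by parts -/

theorem memLp_one_add_abs_pow (q : ℕ) (v : NNReal) :
    MemLp (fun x : ℝ => (1 + |x|) ^ q) 2 (gaussianReal 0 v) := by
  have hc : Continuous fun x : ℝ => (1 + |x|) ^ q := by fun_prop
  refine (memLp_two_iff_integrable_sq hc.aestronglyMeasurable).2 ?_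
  have h1 : MemLp (fun x : ℝ => 1 + |x|) ((2 * q : ℕ) : ENNReal) (gaussianReal 0 v) := by
    have h2 : MemLp (fun x : ℝ => |x|) ((2 * q : ℕ) : ENNReal) (gaussianReal 0 v) :=
      (memLp_id_gaussianReal' _ (ENNReal.natCast_ne_top _)).abs
    exact (memLp_const (1 : ℝ)).add h2
  refine h1.integrable_norm_pow'.congr (ae_of_all _ fun x => ?_)
  have h3 : ‖1 + |x|‖ = 1 + |x| := abs_of_nonneg (by positivity)
  simp only [h3]
  rw [mul_comm, pow_mul]

theorem memLp_gaussianReal_of_growth {φ : ℝ → ℝ} (hφ : Measurable φ) {C : ℝ} {q : ℕ}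
    (h : ∀ x, |φ x| ≤ C * (1 + |x|) ^ q) (v : NNReal) : MemLp φ 2 (gaussianReal 0 v) :=
  ((memLp_one_add_abs_pow q v).const_mul C).mono' hφ.aestronglyMeasurable
    (ae_of_all _ fun x => h x)

theorem integrable_gaussianReal_of_growth {φ : ℝ → ℝ} (hφ : Measurable φ) {C : ℝ} {q : ℕ}
    (h : ∀ x, |φ x| ≤ C * (1 + |x|) ^ q) (v : NNReal) : Integrable φ (gaussianReal 0 v) :=
  (memLp_gaussianReal_of_growth hφ h v).integrable one_le_two

theorem hasDerivAt_gaussianPDFReal_std (x : ℝ) :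
    HasDerivAt (gaussianPDFReal 0 1) (-x * gaussianPDFReal 0 1 x) x := by
  have h : HasDerivAt (fun x : ℝ => -(x - 0) ^ 2 / (2 * ((1 : NNReal) : ℝ))) (-x) x := by
    have := (((hasDerivAt_id x).sub_const 0).pow 2).neg.div_const (2 * ((1 : NNReal) : ℝ))
    convert! this using 1
    simp
    ring
  have h2 := (h.exp).const_mul (√(2 * Real.pi * ((1 : NNReal) : ℝ)))⁻¹
  rw [gaussianPDFReal_def]
  convert! h2 using 1
  ring

theorem integrable_mul_gaussianPDFReal {φ : ℝ → ℝ} (h : Integrable φ (gaussianReal 0 1)) :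
    Integrable (fun x => φ x * gaussianPDFReal 0 1 x) := by
  rw [gaussianReal_of_var_ne_zero _ one_ne_zero,
    integrable_withDensity_iff (measurable_gaussianPDF 0 1)
      (ae_of_all _ fun _ => gaussianPDF_lt_top)] at h
  simpa [toReal_gaussianPDF] using h

/-- Gaussian integration by parts (Stein's identity), for a scaled argument. -/
theorem integral_mul_comp_gaussianReal {φ : ℝ → ℝ} (hφ : Differentiable ℝ φ) (σ : ℝ)
    (h0 : Integrable (fun x => φ (σ * x)) (gaussianReal 0 1))
    (h1 : Integrable (fun x => x * φ (σ * x)) (gaussianReal 0 1))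
    (h2 : Integrable (fun x => deriv φ (σ * x)) (gaussianReal 0 1)) :
    ∫ x, x * φ (σ * x) ∂(gaussianReal 0 1) =
      σ * ∫ x, deriv φ (σ * x) ∂(gaussianReal 0 1) := by
  have hu : ∀ x, HasDerivAt (fun x => φ (σ * x)) (σ * deriv φ (σ * x)) x := by
    intro x
    have := (hφ (σ * x)).hasDerivAt.comp x ((hasDerivAt_id x).const_mul σ)
    convert! this using 1
    simp [mul_comm]
  have key := integral_mul_deriv_eq_deriv_mul_of_integrable (u := fun x => φ (σ * x))
    (v := gaussianPDFReal 0 1) (u' := fun x => σ * deriv φ (σ * x))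
    (v' := fun x => -x * gaussianPDFReal 0 1 x) (fun x _ => hu x)
    (fun x _ => hasDerivAt_gaussianPDFReal_std x)
    ((integrable_mul_gaussianPDFReal h1).neg.congr (ae_of_all _ fun x => by simp; ring))
    (integrable_mul_gaussianPDFReal (h2.const_mul σ)) (integrable_mul_gaussianPDFReal h0)
  rw [← integral_const_mul, integral_gaussianReal_eq_integral_smul one_ne_zero,
    integral_gaussianReal_eq_integral_smul one_ne_zero]
  simp only [smul_eq_mul]
  calc ∫ x, gaussianPDFReal 0 1 x * (x * φ (σ * x))
      = -∫ x, φ (σ * x) * (-x * gaussianPDFReal 0 1 x) := by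
        rw [← integral_neg]
        exact integral_congr_ae (ae_of_all _ fun x => by simp; ring)
    _ = ∫ x, gaussianPDFReal 0 1 x * (σ * deriv φ (σ * x)) := by
        rw [key, neg_neg]
        exact integral_congr_ae (ae_of_all _ fun x => by simp; ring)

section Growth

variable {φ : ℝ → ℝ} {L : ℝ} {q : ℕ}

theorem one_add_pow_add_pow_le {R a b x : ℝ} (hR : 1 ≤ R) (ha : |a| ≤ R) (hb : |b| ≤ R) :
    1 + |a * x| ^ q + |b * x| ^ q ≤ 3 * R ^ q * (1 + |x|) ^ q := by
  have h : ∀ a : ℝ, |a| ≤ R → |a * x| ^ q ≤ R ^ q * (1 + |x|) ^ q := by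
    intro a ha
    rw [← mul_pow, abs_mul]
    gcongr
    linarith
  have h1 : 1 ≤ R ^ q * (1 + |x|) ^ q := by
    rw [← mul_pow]
    exact one_le_pow₀ (by nlinarith [abs_nonneg x])
  linarith [h a ha, h b hb]

/-- A function with polynomially growing Lipschitz constant, evaluated at `s * x`, is Lipschitz in
the scale `s`. -/
theorem abs_sub_scale_le (hL : 0 ≤ L)
    (h : ∀ x y, |φ x - φ y| ≤ L * (1 + |x| ^ q + |y| ^ q) * |x - y|)
    {R : ℝ} (hR : 1 ≤ R) {a b : ℝ} (ha : |a| ≤ R) (hb : |b| ≤ R) (x : ℝ) :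
    |φ (a * x) - φ (b * x)| ≤
      |a - b| * ((|φ 0| + 3 * L * R ^ q * R) * (1 + |x|) ^ (q + 1)) := by
  refine (h _ _).trans ?_
  have h1 : |a * x - b * x| = |a - b| * |x| := by rw [← sub_mul, abs_mul]
  have h2 := one_add_pow_add_pow_le (q := q) (x := x) hR ha hb
  rw [h1]
  have hR0 : 0 ≤ R := by linarith
  calc L * (1 + |a * x| ^ q + |b * x| ^ q) * (|a - b| * |x|)
      ≤ L * (3 * R ^ q * (1 + |x|) ^ q) * (|a - b| * (1 + |x|)) := by
        gcongr
        linarith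
    _ = |a - b| * ((3 * L * R ^ q * 1) * (1 + |x|) ^ (q + 1)) := by ring
    _ ≤ _ := by
        have : 3 * L * R ^ q * 1 ≤ |φ 0| + 3 * L * R ^ q * R := by
          have : 3 * L * R ^ q * 1 ≤ 3 * L * R ^ q * R := by gcongr
          linarith [abs_nonneg (φ 0)]
        gcongr

/-- The constant is that of `abs_sub_scale_le`, so that one bound serves both purposes. -/
theorem abs_scale_le (hL : 0 ≤ L)
    (h : ∀ x y, |φ x - φ y| ≤ L * (1 + |x| ^ q + |y| ^ q) * |x - y|)
    {R : ℝ} (hR : 1 ≤ R) {a : ℝ} (ha : |a| ≤ R) (x : ℝ) :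
    |φ (a * x)| ≤ (|φ 0| + 3 * L * R ^ q * R) * (1 + |x|) ^ (q + 1) := by
  have hR0 : 0 ≤ R := by linarith
  have h1 := h (a * x) (0 * x)
  have h2 := one_add_pow_add_pow_le (q := q) (x := x) hR ha (by simpa using hR0 : |(0 : ℝ)| ≤ R)
  have h3 : |φ (a * x)| ≤ |φ 0| + |φ (a * x) - φ (0 * x)| := by
    have := abs_add_le (φ (0 * x)) (φ (a * x) - φ (0 * x))
    rw [add_sub_cancel] at this
    rwa [zero_mul] at this ⊢
  have h4 : |φ (a * x) - φ (0 * x)| ≤ 3 * L * R ^ q * R * (1 + |x|) ^ (q + 1) := by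
    refine h1.trans ?_
    have h5 : |a * x - 0 * x| = |a| * |x| := by rw [← sub_mul, sub_zero, abs_mul]
    rw [h5]
    calc L * (1 + |a * x| ^ q + |0 * x| ^ q) * (|a| * |x|)
        ≤ L * (3 * R ^ q * (1 + |x|) ^ q) * (R * (1 + |x|)) := by
          gcongr
          linarith
      _ = _ := by ring
  have h5 : 1 ≤ (1 + |x|) ^ (q + 1) := one_le_pow₀ (by linarith [abs_nonneg x])
  nlinarith [abs_nonneg (φ 0)]

theorem abs_deriv_le_of_growth (hL : 0 ≤ L) (hφ : Differentiable ℝ φ)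
    (h : ∀ x y, |φ x - φ y| ≤ L * (1 + |x| ^ q + |y| ^ q) * |x - y|) (x : ℝ) :
    |deriv φ x| ≤ 3 * L * (1 + |x|) ^ q := by
  refine (hφ x).hasDerivAt.le_of_lip' (by positivity) ?_
  filter_upwards [Metric.ball_mem_nhds x one_pos] with y hy
  rw [Metric.mem_ball, Real.dist_eq] at hy
  refine (h y x).trans ?_
  rw [Real.norm_eq_abs]
  refine mul_le_mul_of_nonneg_right ?_ (abs_nonneg _)
  have h1 : |y| ≤ 1 + |x| := by
    have := abs_sub_abs_le_abs_sub y x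
    linarith
  have h2 : |y| ^ q ≤ (1 + |x|) ^ q := by gcongr
  have h3 : |x| ^ q ≤ (1 + |x|) ^ q := by gcongr; linarith
  have h4 : 1 ≤ (1 + |x|) ^ q := one_le_pow₀ (by linarith [abs_nonneg x])
  calc L * (1 + |y| ^ q + |x| ^ q) ≤ L * (3 * (1 + |x|) ^ q) := by
        gcongr
        linarith
    _ = _ := by ring

end Growth

/-! ### Empirical averages of nearby vectors -/

theorem empAvg_sq_eq {d : ℕ} (x : EuclideanSpace ℝ (Fin d)) :
    empAvg (fun y => y ^ 2) x.ofLp = (‖x‖ * (√(d : ℝ))⁻¹) ^ 2 := by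
  rw [mul_pow, EuclideanSpace.real_norm_sq_eq, inv_pow, Real.sq_sqrt (Nat.cast_nonneg d), empAvg,
    one_div, mul_comm]

/-- This holds in dimension `0` as well, where both sides vanish. -/
theorem sum_eq_mul_empAvg {m : ℕ} (ψ : ℝ → ℝ) (x : Fin m → ℝ) :
    ∑ j, ψ (x j) = m * empAvg ψ x := by
  rcases m.eq_zero_or_pos with rfl | hm
  · simp
  · rw [empAvg, ← mul_assoc, mul_one_div_cancel (by positivity), one_mul]

/-- The empirical `ℓ¹` distance is at most the normalised Euclidean distance. -/
theorem abs_empAvg_sub_le {d : ℕ} {K : NNReal} {ψ : ℝ → ℝ} (hψ : LipschitzWith K ψ)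
    (x y : EuclideanSpace ℝ (Fin d)) :
    |empAvg ψ x.ofLp - empAvg ψ y.ofLp| ≤ K * (‖x - y‖ * (√(d : ℝ))⁻¹) := by
  have h1 : |empAvg ψ x.ofLp - empAvg ψ y.ofLp| ≤ K * empAvg (fun z => |z|) (x - y).ofLp := by
    rw [empAvg, empAvg, ← mul_sub, ← Finset.sum_sub_distrib, abs_mul,
      abs_of_nonneg (by positivity : (0 : ℝ) ≤ 1 / (d : ℝ)), empAvg, mul_left_comm, Finset.mul_sum]
    refine mul_le_mul_of_nonneg_left ?_ (by positivity)
    refine (Finset.abs_sum_le_sum_abs _ _).trans (Finset.sum_le_sum fun i _ => ?_)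
    simpa [Real.dist_eq] using hψ.dist_le_mul (x i) (y i)
  refine h1.trans (mul_le_mul_of_nonneg_left ?_ K.2)
  refine abs_le_of_sq_le_sq' ?_ (by positivity) |>.2
  rw [← empAvg_sq_eq, empAvg, empAvg, mul_pow]
  have h2 := sq_sum_le_card_mul_sum_sq (s := Finset.univ) (f := fun i => |(x - y).ofLp i|)
  simp only [sq_abs, Finset.card_univ, Fintype.card_fin] at h2
  rcases d.eq_zero_or_pos with rfl | hd
  · simp
  · calc (1 / (d : ℝ)) ^ 2 * (∑ i, |(x - y).ofLp i|) ^ 2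
        ≤ (1 / (d : ℝ)) ^ 2 * (d * ∑ i, (x - y).ofLp i ^ 2) := by gcongr
      _ = 1 / (d : ℝ) * ∑ i, (x - y).ofLp i ^ 2 := by field_simp

section Close

variable {ι : Type*} {F : Filter ι} {d : ι → ℕ} {x y : ∀ i, EuclideanSpace ℝ (Fin (d i))}

theorem tendsto_empAvg_of_close
    (h : Tendsto (fun i => ‖x i - y i‖ * (√(d i : ℝ))⁻¹) F (𝓝 0)) {K : NNReal} {ψ : ℝ → ℝ}
    (hψ : LipschitzWith K ψ) {l : ℝ} (hy : Tendsto (fun i => empAvg ψ (y i).ofLp) F (𝓝 l)) :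
    Tendsto (fun i => empAvg ψ (x i).ofLp) F (𝓝 l) := by
  have h1 : Tendsto (fun i => empAvg ψ (x i).ofLp - empAvg ψ (y i).ofLp) F (𝓝 0) := by
    refine squeeze_zero_norm (fun i => abs_empAvg_sub_le hψ (x i) (y i)) ?_
    simpa using h.const_mul (K : ℝ)
  simpa using h1.add hy

theorem tendsto_norm_of_empAvg_sq {ρ : ℝ}
    (h : Tendsto (fun i => empAvg (fun z => z ^ 2) (x i).ofLp) F (𝓝 ρ)) :
    Tendsto (fun i => ‖x i‖ * (√(d i : ℝ))⁻¹) F (𝓝 √ρ) := by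
  refine h.sqrt.congr fun i => ?_
  rw [empAvg_sq_eq, Real.sqrt_sq (by positivity)]

theorem tendsto_empAvg_sq_of_close
    (h : Tendsto (fun i => ‖x i - y i‖ * (√(d i : ℝ))⁻¹) F (𝓝 0)) {l : ℝ} (hl : 0 ≤ l)
    (hy : Tendsto (fun i => empAvg (fun z => z ^ 2) (y i).ofLp) F (𝓝 l)) :
    Tendsto (fun i => empAvg (fun z => z ^ 2) (x i).ofLp) F (𝓝 l) := by
  have h1 : Tendsto (fun i => ‖x i‖ * (√(d i : ℝ))⁻¹ - ‖y i‖ * (√(d i : ℝ))⁻¹) F (𝓝 0) := by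
    refine squeeze_zero_norm (fun i => ?_) h
    rw [← sub_mul, Real.norm_eq_abs, abs_mul, abs_of_nonneg (by positivity : 0 ≤ (√(d i : ℝ))⁻¹)]
    exact mul_le_mul_of_nonneg_right (abs_norm_sub_norm_le _ _) (by positivity)
  have h2 := ((h1.add (tendsto_norm_of_empAvg_sq hy)).pow 2)
  rw [zero_add, Real.sq_sqrt hl] at h2
  refine h2.congr fun i => ?_
  rw [sub_add_cancel, empAvg_sq_eq]

end Close

/-! ### Limits of the ingredients of one step -/

theorem measure_stdGaussian_deviation_le {d : ℕ} {φ : Fin d → ℝ → ℝ}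
    (hφ : ∀ i, MemLp (φ i) 2 (gaussianReal 0 1)) {V : ℝ}
    (hV : ∑ i, Var[φ i; gaussianReal 0 1] ≤ V) {ε : ℝ} (hε : 0 < ε) :
    stdGaussian (EuclideanSpace ℝ (Fin d))
        {x | ε ≤ |∑ i, φ i (x i) - ∑ i, ∫ y, φ i y ∂(gaussianReal 0 1)|} ≤
      ENNReal.ofReal (V / ε ^ 2) := by
  rw [← map_pi_eq_stdGaussian]
  exact ((MeasurableEquiv.toLp 2 (Fin d → ℝ)).map_apply _).trans_le
    (measure_pi_deviation_le hφ hV hε)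

theorem integral_sq_gaussianReal_std : ∫ y, y ^ 2 ∂(gaussianReal 0 1) = 1 := by
  have h := variance_eq_sub (memLp_id_gaussianReal (μ := 0) (v := 1) 2)
  rw [variance_id_gaussianReal] at h
  simpa using h.symm

section Ingredients

variable {n d : ℕ → ℕ}

theorem tendsto_norm_stdGaussian (hd : Tendsto d atTop atTop) :
    Tendsto (fun p : Σ N, EuclideanSpace ℝ (Fin (d N)) => ‖p.2‖ * (√(d p.1 : ℝ))⁻¹)
      (probFilter fun N => stdGaussian (EuclideanSpace ℝ (Fin (d N)))) (𝓝 1) := by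
  have hm : MemLp (fun y : ℝ => y ^ 2) 2 (gaussianReal 0 1) :=
    memLp_gaussianReal_of_growth (by fun_prop) (C := 1) (q := 2)
      (fun x => by rw [abs_of_nonneg (sq_nonneg x)]; nlinarith [sq_abs x, abs_nonneg x]) 1
  have h := tendsto_empAvg_pi hd hm
  rw [integral_sq_gaussianReal_std] at h
  have h2 : Tendsto (fun p : Σ N, EuclideanSpace ℝ (Fin (d N)) =>
      empAvg (fun z => z ^ 2) p.2.ofLp)
      (probFilter fun N => stdGaussian (EuclideanSpace ℝ (Fin (d N)))) (𝓝 1) := by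
    simp_rw [← map_pi_eq_stdGaussian]
    refine (tendsto_probFilter_map_iff
      (P := fun N => Measure.pi fun _ : Fin (d N) => gaussianReal 0 1)
      (T := fun N => WithLp.toLp 2)
      (X := fun N (x : EuclideanSpace ℝ (Fin (d N))) => empAvg (fun z => z ^ 2) x.ofLp)
      (fun N => by fun_prop) (fun N => ?_)).2 h
    unfold empAvg
    fun_prop
  simpa using tendsto_norm_of_empAvg_sq (d := fun p : Σ N, EuclideanSpace ℝ (Fin (d N)) => d p.1)
    (x := fun p => p.2) h2

variable {ν : ∀ N, Measure (EuclideanSpace ℝ (Fin (d N)))} [∀ N, IsProbabilityMeasure (ν N)]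

/-- The component of an independent Gaussian vector in the direction of a random vector is
negligible. -/
theorem tendsto_inner_direction_stdGaussian (hd : Tendsto d atTop atTop) :
    Tendsto (fun p : Σ N, EuclideanSpace ℝ (Fin (d N)) × EuclideanSpace ℝ (Fin (d N)) =>
        ⟪direction p.2.1, p.2.2⟫ * (√(d p.1 : ℝ))⁻¹)
      (probFilter fun N => (ν N).prod (stdGaussian (EuclideanSpace ℝ (Fin (d N))))) (𝓝 0) := by
  refine tendsto_probFilter_prod_of_fiberwise
    (X := fun N (p : EuclideanSpace ℝ (Fin (d N)) × EuclideanSpace ℝ (Fin (d N))) =>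
      ⟪direction p.1, p.2⟫ * (√(d N : ℝ))⁻¹) (fun N => ?_) fun ε hε =>
      ⟨_, tendsto_ofReal_div_mul_atTop hd 1 (ε ^ 2), fun N w => ?_⟩
  · exact ((measurable_direction.comp measurable_fst).inner measurable_snd).mul_const _
  set r := (√(d N : ℝ))⁻¹ with hr
  have h := measure_stdGaussian_deviation_le (d := d N) (V := 1 / (d N : ℝ))
    (φ := fun i y => (direction w i * r) * y)
    (fun i => (memLp_id_gaussianReal (μ := 0) (v := 1) 2).const_mul _) ?_ hε
  · have h1 : ∀ x : EuclideanSpace ℝ (Fin (d N)),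
        ∑ i, direction w i * r * x i = ⟪direction w, x⟫ * r := by
      intro x
      rw [PiLp.inner_apply, Finset.sum_mul]
      refine Finset.sum_congr rfl fun i _ => ?_
      simp
      ring
    have h2 : ∑ i, ∫ y, (direction w i * r) * y ∂(gaussianReal 0 1) = 0 := by
      refine Finset.sum_eq_zero fun i _ => ?_
      rw [integral_const_mul]
      simp
    simpa only [h1, h2] using h
  · have h3 : ∀ i : Fin (d N), Var[fun y => direction w i * r * y; gaussianReal 0 1] =
        (direction w i) ^ 2 * r ^ 2 := by
      intro i
      rw [variance_const_mul]
      have : Var[fun y : ℝ => y; gaussianReal 0 1] = 1 := by simp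
      rw [this]
      ring
    simp_rw [h3]
    rw [← Finset.sum_mul, ← EuclideanSpace.real_norm_sq_eq, hr, inv_pow,
      Real.sq_sqrt (Nat.cast_nonneg _), ← one_div]
    exact mul_le_of_le_one_left (by positivity)
      (pow_le_one₀ (norm_nonneg _) (norm_direction_le w))

/-- Adding independent Gaussian noise to a random vector: conditionally on the vector, empirical
averages concentrate around the empirical average of the smoothed test function. -/
theorem tendsto_empAvg_add_noise (hd : Tendsto d atTop atTop) (κ b : ℝ) {K : NNReal} {B : ℝ}
    {ψ : ℝ → ℝ} (hψ : LipschitzWith K ψ) (hB : ∀ y, |ψ y| ≤ B) :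
    Tendsto (fun p : Σ N, EuclideanSpace ℝ (Fin (d N)) × EuclideanSpace ℝ (Fin (d N)) =>
        empAvg ψ (κ • p.2.1 + b • p.2.2).ofLp -
          empAvg (fun x => ∫ y, ψ (κ * x + b * y) ∂(gaussianReal 0 1)) p.2.1.ofLp)
      (probFilter fun N => (ν N).prod (stdGaussian (EuclideanSpace ℝ (Fin (d N))))) (𝓝 0) := by
  have hψm : Measurable ψ := hψ.continuous.measurable
  have hB0 : 0 ≤ B := (abs_nonneg _).trans (hB 0)
  refine tendsto_probFilter_prod_of_fiberwise
    (X := fun N (p : EuclideanSpace ℝ (Fin (d N)) × EuclideanSpace ℝ (Fin (d N))) =>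
      empAvg ψ (κ • p.1 + b • p.2).ofLp -
          empAvg (fun x => ∫ y, ψ (κ * x + b * y) ∂(gaussianReal 0 1)) p.1.ofLp)
    (fun N => ?_) fun ε hε =>
      ⟨_, tendsto_ofReal_div_mul_atTop hd (B ^ 2) (ε ^ 2), fun N w => ?_⟩
  · have h1 : Measurable fun x : ℝ => ∫ y, ψ (κ * x + b * y) ∂(gaussianReal 0 1) :=
      (StronglyMeasurable.integral_prod_right
        (f := fun x y : ℝ => ψ (κ * x + b * y))
        (hψm.comp (by fun_prop)).stronglyMeasurable).measurable
    exact ((Finset.measurable_sum _ fun i _ => hψm.comp (by fun_prop)).const_mul _).sub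
      ((Finset.measurable_sum _ fun i _ => h1.comp (by fun_prop)).const_mul _)
  have hle : ∀ (i : Fin (d N)) (y : ℝ), |1 / (d N : ℝ) * ψ (κ * w i + b * y)| ≤ 1 / (d N : ℝ) * B :=
    fun i y => by
      rw [abs_mul, abs_of_nonneg (by positivity : (0 : ℝ) ≤ 1 / (d N : ℝ))]
      exact mul_le_mul_of_nonneg_left (hB _) (by positivity)
  have hmem : ∀ i : Fin (d N), Measurable fun y => 1 / (d N : ℝ) * ψ (κ * w i + b * y) :=
    fun i => (hψm.comp (by fun_prop)).const_mul _
  have h := measure_stdGaussian_deviation_le (d := d N) (V := B ^ 2 / (d N : ℝ))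
    (φ := fun i y => 1 / (d N : ℝ) * ψ (κ * w i + b * y))
    (fun i => MemLp.of_bound (hmem i).aestronglyMeasurable (1 / (d N : ℝ) * B)
      (ae_of_all _ fun y => hle i y)) ?_ hε
  · have h1 : ∀ x : EuclideanSpace ℝ (Fin (d N)),
        ∑ i, 1 / (d N : ℝ) * ψ (κ * w i + b * x i) = empAvg ψ (κ • w + b • x).ofLp :=
      fun x => (Finset.mul_sum _ _ _).symm
    have h2 : ∑ i, ∫ y, 1 / (d N : ℝ) * ψ (κ * w i + b * y) ∂(gaussianReal 0 1) =
        empAvg (fun x => ∫ y, ψ (κ * x + b * y) ∂(gaussianReal 0 1)) w.ofLp := by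
      simp only [integral_const_mul]
      exact (Finset.mul_sum _ _ _).symm
    simpa only [h1, h2, sub_zero] using h
  · have h3 : ∀ i : Fin (d N),
        Var[fun y => 1 / (d N : ℝ) * ψ (κ * w i + b * y); gaussianReal 0 1] ≤
          (1 / (d N : ℝ) * B) ^ 2 := by
      intro i
      have := variance_le_sq_of_bounded (μ := gaussianReal 0 1)
        (ae_of_all _ fun y => abs_le.1 (hle i y)) (hmem i).aemeasurable
      convert this using 2
      ring
    refine (Finset.sum_le_sum fun i _ => h3 i).trans (le_of_eq ?_)
    rcases (d N).eq_zero_or_pos with h0 | h0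
    · simp [h0]
    · simp
      field_simp

end Ingredients

/-! ### Propagation of the empirical law through one step -/

/-- The empirical distributions of random vectors with laws `ν N` converge to `μ` in probability,
tested against pseudo-Lipschitz functions of order `2`. -/
def EmpiricalLawTendsto (d : ℕ → ℕ) (ν : ∀ N, Measure (EuclideanSpace ℝ (Fin (d N))))
    (μ : Measure ℝ) : Prop :=
  ∀ ψ : ℝ → ℝ, IsPseudoLipschitz 2 ψ →
    Tendsto (fun p : Σ N, EuclideanSpace ℝ (Fin (d N)) => empAvg ψ p.2.ofLp) (probFilter ν)
      (𝓝 (∫ x, ψ x ∂μ))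

section Scale

variable {φ : ℝ → ℝ} {L : ℝ} {q : ℕ}

/-- Empirical averages of a polynomially growing function of `s, g j` at a random scale `s → σ`,
for Gaussian `g j`. -/
theorem tendsto_empAvg_scale_gaussian {ι : Type*} {F : Filter ι} {n : ℕ → ℕ} {N : ι → ℕ}
    {g : ∀ i, Fin (n (N i)) → ℝ} (hn : Tendsto n atTop atTop)
    (hg : Tendsto (fun i => (⟨N i, g i⟩ : Σ N, (Fin (n N) → ℝ))) F
      (probFilter fun N => Measure.pi fun _ : Fin (n N) => gaussianReal 0 1))
    {s : ι → ℝ} {σ : ℝ} (hs : Tendsto s F (𝓝 σ)) {Φ : ℝ → ℝ → ℝ} {C C' : ℝ} {r r' : ℕ}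
    (hm : Measurable (Φ σ)) (hΦ : ∀ x, |Φ σ x| ≤ C * (1 + |x|) ^ r)
    (hΦ' : ∀ s, |s| ≤ |σ| + 1 → ∀ x, |Φ s x - Φ σ x| ≤ |s - σ| * (C' * (1 + |x|) ^ r')) :
    Tendsto (fun i => empAvg (Φ (s i)) (g i)) F (𝓝 (∫ x, Φ σ x ∂(gaussianReal 0 1))) := by
  have h1 := (tendsto_empAvg_pi hn ((memLp_one_add_abs_pow r' 1).const_mul C')).comp hg
  have h2 := (tendsto_empAvg_pi hn (memLp_gaussianReal_of_growth hm hΦ 1)).comp hg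
  simp only [Function.comp_def] at h1 h2
  exact tendsto_empAvg_parameter (m := fun i => n (N i)) (g := g) hs (lt_add_one |σ|) hΦ' h1 h2

theorem tendsto_empAvg_sq_scale {ι : Type*} {F : Filter ι} {n : ℕ → ℕ} {N : ι → ℕ}
    {g : ∀ i, Fin (n (N i)) → ℝ} (hn : Tendsto n atTop atTop)
    (hg : Tendsto (fun i => (⟨N i, g i⟩ : Σ N, (Fin (n N) → ℝ))) F
      (probFilter fun N => Measure.pi fun _ : Fin (n N) => gaussianReal 0 1))
    {s : ι → ℝ} {σ : ℝ} (hs : Tendsto s F (𝓝 σ)) (hφm : Measurable φ) (hL : 0 ≤ L)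
    (h : ∀ x y, |φ x - φ y| ≤ L * (1 + |x| ^ q + |y| ^ q) * |x - y|) :
    Tendsto (fun i => empAvg (fun x => φ (s i * x) ^ 2) (g i)) F
      (𝓝 (∫ x, φ (σ * x) ^ 2 ∂(gaussianReal 0 1))) := by
  have hR : 1 ≤ |σ| + 1 := by linarith [abs_nonneg σ]
  have hσ : |σ| ≤ |σ| + 1 := by linarith
  set C := |φ 0| + 3 * L * (|σ| + 1) ^ q * (|σ| + 1) with hC
  have hC0 : 0 ≤ C := by positivity
  refine tendsto_empAvg_scale_gaussian (Φ := fun s x => φ (s * x) ^ 2) (C := C ^ 2)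
    (C' := C * (2 * C)) (r := (q + 1) * 2) (r' := (q + 1) * 2) hn hg hs
    ((hφm.comp (by fun_prop)).pow_const 2) (fun x => ?_) (fun s hs x => ?_)
  · rw [abs_pow, pow_mul, ← mul_pow]
    exact pow_le_pow_left₀ (abs_nonneg _) (abs_scale_le hL h hR hσ x) 2
  · have h1 := abs_sub_scale_le hL h hR hs hσ x
    have h2 := abs_scale_le hL h hR hs x
    have h3 := abs_scale_le hL h hR hσ x
    rw [sq_sub_sq, mul_comm, abs_mul]
    calc |φ (s * x) - φ (σ * x)| * |φ (s * x) + φ (σ * x)|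
        ≤ (|s - σ| * (C * (1 + |x|) ^ (q + 1))) * (2 * (C * (1 + |x|) ^ (q + 1))) := by
          gcongr
          exact (abs_add_le _ _).trans (by linarith)
      _ = _ := by ring

theorem tendsto_empAvg_mul_scale {ι : Type*} {F : Filter ι} {n : ℕ → ℕ} {N : ι → ℕ}
    {g : ∀ i, Fin (n (N i)) → ℝ} (hn : Tendsto n atTop atTop)
    (hg : Tendsto (fun i => (⟨N i, g i⟩ : Σ N, (Fin (n N) → ℝ))) F
      (probFilter fun N => Measure.pi fun _ : Fin (n N) => gaussianReal 0 1))
    {s : ι → ℝ} {σ : ℝ} (hs : Tendsto s F (𝓝 σ)) (hφm : Measurable φ) (hL : 0 ≤ L)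
    (h : ∀ x y, |φ x - φ y| ≤ L * (1 + |x| ^ q + |y| ^ q) * |x - y|) :
    Tendsto (fun i => empAvg (fun x => φ (s i * x) * x) (g i)) F
      (𝓝 (∫ x, φ (σ * x) * x ∂(gaussianReal 0 1))) := by
  have hR : 1 ≤ |σ| + 1 := by linarith [abs_nonneg σ]
  have hσ : |σ| ≤ |σ| + 1 := by linarith
  set C := |φ 0| + 3 * L * (|σ| + 1) ^ q * (|σ| + 1) with hC
  have hC0 : 0 ≤ C := by positivity
  have hx : ∀ x : ℝ, |x| ≤ 1 + |x| := fun x => by linarith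
  refine tendsto_empAvg_scale_gaussian (Φ := fun s x => φ (s * x) * x) (C := C)
    (C' := C) (r := q + 2) (r' := q + 2) hn hg hs
    ((hφm.comp (by fun_prop)).mul measurable_id) (fun x => ?_) (fun s hs x => ?_)
  · rw [abs_mul]
    calc |φ (σ * x)| * |x| ≤ (C * (1 + |x|) ^ (q + 1)) * (1 + |x|) := by
          gcongr
          · exact abs_scale_le hL h hR hσ x
          · exact hx x
      _ = _ := by ring
  · rw [← sub_mul, abs_mul]
    calc |φ (s * x) - φ (σ * x)| * |x|
        ≤ (|s - σ| * (C * (1 + |x|) ^ (q + 1))) * (1 + |x|) := by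
          gcongr
          · exact abs_sub_scale_le hL h hR hs hσ x
          · exact hx x
      _ = _ := by ring

/-- Stein's identity under the growth condition. -/
theorem integral_mul_scale_eq (hφ : Differentiable ℝ φ) (hL : 0 ≤ L)
    (h : ∀ x y, |φ x - φ y| ≤ L * (1 + |x| ^ q + |y| ^ q) * |x - y|) (σ : ℝ) :
    ∫ x, φ (σ * x) * x ∂(gaussianReal 0 1) =
      σ * ∫ x, deriv φ (σ * x) ∂(gaussianReal 0 1) := by
  have hR : 1 ≤ |σ| + 1 := by linarith [abs_nonneg σ]
  have hσ : |σ| ≤ |σ| + 1 := by linarith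
  set C := |φ 0| + 3 * L * (|σ| + 1) ^ q * (|σ| + 1) with hC
  have hC0 : 0 ≤ C := by positivity
  have hm : Measurable fun x => φ (σ * x) := hφ.continuous.measurable.comp (by fun_prop)
  rw [← integral_mul_comp_gaussianReal hφ σ]
  · exact integral_congr_ae (ae_of_all _ fun x => mul_comm _ _)
  · exact integrable_gaussianReal_of_growth hm (abs_scale_le hL h hR hσ) 1
  · refine integrable_gaussianReal_of_growth (C := C) (q := q + 2) (measurable_id'.mul hm)
      (fun x => ?_) 1
    show |x * φ (σ * x)| ≤ _
    rw [abs_mul]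
    calc |x| * |φ (σ * x)| ≤ (1 + |x|) * (C * (1 + |x|) ^ (q + 1)) := by
          gcongr
          · linarith
          · exact abs_scale_le hL h hR hσ x
      _ = _ := by ring
  · refine integrable_gaussianReal_of_growth (C := 3 * L * (|σ| + 1) ^ q) (q := q)
      ((measurable_deriv φ).comp (by fun_prop)) (fun x => ?_) 1
    refine (abs_deriv_le_of_growth hL hφ h _).trans ?_
    rw [mul_assoc (3 * L), ← mul_pow]
    gcongr
    rw [abs_mul]
    nlinarith [abs_nonneg x, abs_nonneg σ]

end Scale

section Noise

variable {μ : Measure ℝ} [IsProbabilityMeasure μ] (κ b : ℝ)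

theorem integrable_prod_gaussian_sq (hμ : Integrable (fun x => x ^ 2) μ) :
    Integrable (fun p : ℝ × ℝ => (κ * p.1 + b * p.2) ^ 2) (μ.prod (gaussianReal 0 1)) := by
  have hx : MemLp (fun p : ℝ × ℝ => p.1) 2 (μ.prod (gaussianReal 0 1)) :=
    ((memLp_two_iff_integrable_sq aestronglyMeasurable_id).2 hμ).comp_fst _
  have hy : MemLp (fun p : ℝ × ℝ => p.2) 2 (μ.prod (gaussianReal 0 1)) :=
    (memLp_id_gaussianReal (μ := 0) (v := 1) 2).comp_snd _
  exact ((hx.const_mul κ).add (hy.const_mul b)).integrable_sq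

theorem integral_sq_map_add_gaussian (hμ : Integrable (fun x => x ^ 2) μ) :
    ∫ x, x ^ 2 ∂((μ.prod (gaussianReal 0 1)).map fun p => κ * p.1 + b * p.2) =
      κ ^ 2 * ∫ x, x ^ 2 ∂μ + b ^ 2 := by
  rw [integral_map (by fun_prop) (by fun_prop),
    integral_prod _ (integrable_prod_gaussian_sq κ b hμ)]
  have h1 : ∀ x : ℝ, ∫ y, (κ * x + b * y) ^ 2 ∂(gaussianReal 0 1) = κ ^ 2 * x ^ 2 + b ^ 2 := by
    intro x
    have e : ∀ y : ℝ, (κ * x + b * y) ^ 2 =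
        (κ ^ 2 * x ^ 2 + (2 * κ * x * b) * y) + b ^ 2 * y ^ 2 := fun y => by ring
    have hi : Integrable (fun y : ℝ => y) (gaussianReal 0 1) :=
      (memLp_id_gaussianReal (μ := 0) (v := 1) 1).integrable le_rfl
    have hi2 : Integrable (fun y : ℝ => y ^ 2) (gaussianReal 0 1) :=
      (memLp_id_gaussianReal (μ := 0) (v := 1) 2).integrable_sq
    have hi3 : Integrable (fun y : ℝ => κ ^ 2 * x ^ 2 + (2 * κ * x * b) * y) (gaussianReal 0 1) :=
      (integrable_const _).add (hi.const_mul _)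
    simp_rw [e]
    rw [integral_add hi3 (hi2.const_mul _),
      integral_add (integrable_const _) (hi.const_mul _), integral_const_mul (b ^ 2),
      integral_const_mul (2 * κ * x * b), integral_sq_gaussianReal_std]
    simp
  simp_rw [h1]
  rw [integral_add (hμ.const_mul _) (integrable_const _), integral_const_mul]
  simp

theorem integral_map_add_gaussian {K : NNReal} {B : ℝ} {ψ : ℝ → ℝ} (hψ : LipschitzWith K ψ)
    (hB : ∀ y, |ψ y| ≤ B) :
    ∫ x, ψ x ∂((μ.prod (gaussianReal 0 1)).map fun p => κ * p.1 + b * p.2) =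
      ∫ x, ∫ y, ψ (κ * x + b * y) ∂(gaussianReal 0 1) ∂μ := by
  rw [integral_map (by fun_prop) hψ.continuous.aestronglyMeasurable, integral_prod]
  refine Integrable.of_bound (Continuous.aestronglyMeasurable ?_) B
    (ae_of_all _ fun p => hB _)
  exact hψ.continuous.comp (by fun_prop)

/-- Gaussian smoothing preserves Lipschitz functions, so that the smoothed test function is again
admissible. -/
theorem lipschitzWith_integral_gaussian {K : NNReal} {B : ℝ} {ψ : ℝ → ℝ}
    (hψ : LipschitzWith K ψ) (hB : ∀ y, |ψ y| ≤ B) :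
    LipschitzWith (K * ‖κ‖₊) (fun x => ∫ y, ψ (κ * x + b * y) ∂(gaussianReal 0 1)) := by
  have hi : ∀ x, Integrable (fun y => ψ (κ * x + b * y)) (gaussianReal 0 1) := fun x =>
    Integrable.of_bound (hψ.continuous.comp (by fun_prop)).aestronglyMeasurable B
      (ae_of_all _ fun p => hB _)
  refine LipschitzWith.of_dist_le_mul fun x x' => ?_
  rw [dist_eq_norm, ← integral_sub (hi x) (hi x')]
  refine (norm_integral_le_of_norm_le_const (C := K * ‖κ‖₊ * dist x x')
    (ae_of_all _ fun y => ?_)).trans (by simp)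
  rw [← dist_eq_norm]
  refine (hψ.dist_le_mul _ _).trans (le_of_eq ?_)
  rw [mul_assoc]
  congr 1
  rw [Real.dist_eq, Real.dist_eq, add_sub_add_right_eq_sub, ← mul_sub, abs_mul]
  rfl

end Noise

/-- Deterministic comparison of the decoupled step with its limiting form `κ w + b ξ`: the error
has one component from the overlap of the nonlinearity with `g`, one from the norm of the
nonlinearity, and one from the component of `ξ` along `w`. -/
theorem norm_decoupledStep_sub_le {n d : ℕ} (φ : ℝ → ℝ) (c s r κ b : ℝ) (hr : 0 ≤ r)
    (w : EuclideanSpace ℝ (Fin d)) (g : Fin n → ℝ) (ξ : EuclideanSpace ℝ (Fin d)) :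
    ‖decoupledStep φ c s w g ξ - (κ • w + b • ξ)‖ * r ≤
      |(1 - κ) * (‖w‖ * r) + c * r * ∑ j, φ (‖w‖ * s * g j) * g j| +
        |c * √(∑ j, φ (‖w‖ * s * g j) ^ 2) - b| * (‖ξ‖ * r) +
        |c * √(∑ j, φ (‖w‖ * s * g j) ^ 2)| * |⟪direction w, ξ⟫ * r| := by
  set G := ∑ j, φ (‖w‖ * s * g j) * g j
  set H := √(∑ j, φ (‖w‖ * s * g j) ^ 2)
  have e1 : decoupledStep φ c s w g ξ - (κ • w + b • ξ) =
      ((1 - κ) * ‖w‖ + c * G) • direction w + (c * H - b) • ξ -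
        (c * H * ⟪direction w, ξ⟫) • direction w := by
    have hw : (1 - κ) • w = ((1 - κ) * ‖w‖) • direction w := by
      rw [← smul_smul, norm_smul_direction]
    rw [sub_smul, one_smul] at hw
    show w + c • (G • direction w + H • (ξ - ⟪direction w, ξ⟫ • direction w)) - _ = _
    rw [add_smul, ← hw]
    module
  have hd := norm_direction_le w
  have h1 : ‖decoupledStep φ c s w g ξ - (κ • w + b • ξ)‖ ≤
      |(1 - κ) * ‖w‖ + c * G| + |c * H - b| * ‖ξ‖ + |c * H * ⟪direction w, ξ⟫| := by
    rw [e1]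
    refine (norm_sub_le _ _).trans (add_le_add ((norm_add_le _ _).trans (add_le_add ?_ ?_)) ?_)
    · rw [norm_smul]
      exact mul_le_of_le_one_right (norm_nonneg _) hd
    · rw [norm_smul]
      rfl
    · rw [norm_smul]
      exact mul_le_of_le_one_right (norm_nonneg _) hd
  refine (mul_le_mul_of_nonneg_right h1 hr).trans (le_of_eq ?_)
  have e2 : (1 - κ) * (‖w‖ * r) + c * r * G = ((1 - κ) * ‖w‖ + c * G) * r := by ring
  rw [e2, abs_mul _ r, abs_mul _ r, abs_mul (c * H) _, abs_of_nonneg hr]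
  ring

/-- The law of the next iterate, given the law `ν` of the current one: `ν` and independent standard
Gaussian rows are pushed forward by the gradient step, with step size `γ` and the nonlinearity
`φ = f'`. The factors `1 / √d` turn rows of unit variance into rows of the data matrix. -/
noncomputable def stepLaw (n : ℕ) {d : ℕ} (φ : ℝ → ℝ) (γ : ℝ)
    (ν : Measure (EuclideanSpace ℝ (Fin d))) : Measure (EuclideanSpace ℝ (Fin d)) :=
  (ν.prod (Measure.pi fun _ : Fin n => stdGaussian (EuclideanSpace ℝ (Fin d)))).map
    (fun p => rowStep φ (-γ * (√(d : ℝ))⁻¹) (√(d : ℝ))⁻¹ p.1 p.2)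

theorem tendsto_atTop_of_ratio {n d : ℕ → ℕ} {α : ℝ} (hα : 0 < α) (hd : Tendsto d atTop atTop)
    (hnd : Tendsto (fun N => (n N : ℝ) / (d N : ℝ)) atTop (𝓝 α)) : Tendsto n atTop atTop := by
  have hd' : Tendsto (fun N => (d N : ℝ)) atTop atTop := tendsto_natCast_atTop_atTop.comp hd
  refine tendsto_natCast_atTop_iff (R := ℝ).1 ?_
  refine (hnd.pos_mul_atTop hα hd').congr' ?_
  filter_upwards [hd.eventually_ge_atTop 1] with N hN
  have : (d N : ℝ) ≠ 0 := by positivity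
  field_simp

/-- The decoupled step is close to its limiting form `κ w + b ξ`, with `σ` the limiting normalised
length of `w`. Stein's identity turns the overlap of the nonlinearity with `g` into a multiple
of `σ`. -/
theorem tendsto_decoupledStep_sub {n d : ℕ → ℕ} {α : ℝ} (hn : Tendsto n atTop atTop)
    (hnd : Tendsto (fun N => (n N : ℝ) / (d N : ℝ)) atTop (𝓝 α))
    {φ : ℝ → ℝ} (hφ : Differentiable ℝ φ) {L : ℝ} {q : ℕ} (hL : 0 ≤ L)
    (hφL : ∀ x y, |φ x - φ y| ≤ L * (1 + |x| ^ q + |y| ^ q) * |x - y|) (γ σ : ℝ)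
    {ι : Type*} {F : Filter ι} {N : ι → ℕ} {w ξ : ∀ i, EuclideanSpace ℝ (Fin (d (N i)))}
    {g : ∀ i, Fin (n (N i)) → ℝ} (hN : Tendsto N F atTop)
    (hw : Tendsto (fun i => ‖w i‖ * (√(d (N i) : ℝ))⁻¹) F (𝓝 σ))
    (hg : Tendsto (fun i => (⟨N i, g i⟩ : Σ N, (Fin (n N) → ℝ))) F
      (probFilter fun N => Measure.pi fun _ : Fin (n N) => gaussianReal 0 1))
    (hξ : Tendsto (fun i => ‖ξ i‖ * (√(d (N i) : ℝ))⁻¹) F (𝓝 1))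
    (hwξ : Tendsto (fun i => ⟪direction (w i), ξ i⟫ * (√(d (N i) : ℝ))⁻¹) F (𝓝 0)) :
    Tendsto (fun i =>
      ‖decoupledStep φ (-γ * (√(d (N i) : ℝ))⁻¹) (√(d (N i) : ℝ))⁻¹ (w i) (g i) (ξ i) -
        ((1 - γ * α * ∫ x, deriv φ (σ * x) ∂(gaussianReal 0 1)) • w i +
          (-γ * √(α * ∫ x, φ (σ * x) ^ 2 ∂(gaussianReal 0 1))) • ξ i)‖ * (√(d (N i) : ℝ))⁻¹)
      F (𝓝 0) := by
  have hφm : Measurable φ := hφ.continuous.measurable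
  set D := ∫ x, deriv φ (σ * x) ∂(gaussianReal 0 1) with hD
  set κ := 1 - γ * α * D with hκ
  set b := -γ * √(α * ∫ x, φ (σ * x) ^ 2 ∂(gaussianReal 0 1)) with hb
  have hratio := hnd.comp hN
  simp only [Function.comp_def] at hratio
  have hH : Tendsto (fun i => -γ * (√(d (N i) : ℝ))⁻¹ *
      √(∑ j, φ (‖w i‖ * (√(d (N i) : ℝ))⁻¹ * g i j) ^ 2)) F (𝓝 b) := by
    have h1 := (hratio.mul (tendsto_empAvg_sq_scale hn hg hw hφm hL hφL)).sqrt.const_mul (-γ)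
    refine h1.congr fun i => ?_
    rw [mul_assoc, sum_eq_mul_empAvg (fun x => φ (‖w i‖ * (√(d (N i) : ℝ))⁻¹ * x) ^ 2),
      div_mul_eq_mul_div, Real.sqrt_div' _ (Nat.cast_nonneg _), div_eq_inv_mul]
  have hG : Tendsto (fun i => -γ * (√(d (N i) : ℝ))⁻¹ * (√(d (N i) : ℝ))⁻¹ *
      ∑ j, φ (‖w i‖ * (√(d (N i) : ℝ))⁻¹ * g i j) * g i j) F (𝓝 (-γ * (α * (σ * D)))) := by
    have h1 := (hratio.mul (tendsto_empAvg_mul_scale hn hg hw hφm hL hφL)).const_mul (-γ)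
    rw [integral_mul_scale_eq hφ hL hφL] at h1
    refine h1.congr fun i => ?_
    have h2 : (√(d (N i) : ℝ))⁻¹ * (√(d (N i) : ℝ))⁻¹ = (d (N i) : ℝ)⁻¹ := by
      rw [← mul_inv, Real.mul_self_sqrt (Nat.cast_nonneg _)]
    rw [mul_assoc (-γ), h2, sum_eq_mul_empAvg (fun x => φ (‖w i‖ * (√(d (N i) : ℝ))⁻¹ * x) * x)]
    ring
  refine squeeze_zero (fun i => by positivity)
    (fun i => norm_decoupledStep_sub_le φ _ _ _ κ b (by positivity) _ _ _) ?_
  have h4 := ((((hw.const_mul (1 - κ)).add hG).abs).add (((hH.sub_const b).abs).mul hξ)).add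
    (hH.abs.mul hwξ.abs)
  -- the overlap term cancels by the choice of `κ`, the norm term by the choice of `b`
  have e : |(1 - κ) * σ + -γ * (α * (σ * D))| + |b - b| * 1 + |b| * |(0 : ℝ)| = 0 := by
    have : (1 - κ) * σ + -γ * (α * (σ * D)) = 0 := by rw [hκ]; ring
    rw [this]
    simp
  rwa [e] at h4

section AddNoise

variable {d : ℕ → ℕ} {ν : ∀ N, Measure (EuclideanSpace ℝ (Fin (d N)))}
  [∀ N, IsProbabilityMeasure (ν N)] {μ : Measure ℝ} [IsProbabilityMeasure μ]

theorem EmpiricalLawTendsto.tendsto_add_noise_sq (hd : Tendsto d atTop atTop)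
    (hμ : Integrable (fun x => x ^ 2) μ) (h : EmpiricalLawTendsto d ν μ) (κ b : ℝ) :
    Tendsto (fun p : Σ N, EuclideanSpace ℝ (Fin (d N)) × EuclideanSpace ℝ (Fin (d N)) =>
      empAvg (fun z => z ^ 2) (κ • p.2.1 + b • p.2.2).ofLp)
      (probFilter fun N => (ν N).prod (stdGaussian (EuclideanSpace ℝ (Fin (d N)))))
      (𝓝 (∫ x, x ^ 2 ∂((μ.prod (gaussianReal 0 1)).map fun p => κ * p.1 + b * p.2))) := by
  have hw := (tendsto_norm_of_empAvg_sq
    (d := fun p : Σ N, EuclideanSpace ℝ (Fin (d N)) => d p.1)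
    (x := fun p => p.2) (h _ isPseudoLipschitz_two_sq)).comp
    (tendsto_probFilter_measurePreserving fun N =>
      measurePreserving_fst (μ := ν N) (ν := stdGaussian (EuclideanSpace ℝ (Fin (d N)))))
  have hξ := (tendsto_norm_stdGaussian hd).comp
    (tendsto_probFilter_measurePreserving fun N =>
      measurePreserving_snd (μ := ν N) (ν := stdGaussian (EuclideanSpace ℝ (Fin (d N)))))
  have hwξ := tendsto_inner_direction_stdGaussian (ν := ν) hd
  simp only [Function.comp_def] at hw hξ
  have h1 := (((hw.pow 2).const_mul (κ ^ 2)).add ((hw.mul hwξ).const_mul (2 * κ * b))).add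
    ((hξ.pow 2).const_mul (b ^ 2))
  have e : κ ^ 2 * √(∫ x, x ^ 2 ∂μ) ^ 2 + 2 * κ * b * (√(∫ x, x ^ 2 ∂μ) * 0) + b ^ 2 * 1 ^ 2 =
      ∫ x, x ^ 2 ∂((μ.prod (gaussianReal 0 1)).map fun p => κ * p.1 + b * p.2) := by
    rw [integral_sq_map_add_gaussian κ b hμ,
      Real.sq_sqrt (integral_nonneg fun x => sq_nonneg x)]
    ring
  rw [e] at h1
  refine h1.congr fun p => ?_
  have h2 : ‖p.2.1‖ * ⟪direction p.2.1, p.2.2⟫ = ⟪p.2.1, p.2.2⟫ := by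
    rw [← real_inner_smul_left, norm_smul_direction]
  have h3 : ‖κ • p.2.1 + b • p.2.2‖ ^ 2 =
      κ ^ 2 * ‖p.2.1‖ ^ 2 + 2 * κ * b * ⟪p.2.1, p.2.2⟫ + b ^ 2 * ‖p.2.2‖ ^ 2 := by
    rw [norm_add_sq_real, norm_smul, norm_smul, real_inner_smul_left, real_inner_smul_right,
      mul_pow, mul_pow, Real.norm_eq_abs, Real.norm_eq_abs, sq_abs, sq_abs]
    ring
  rw [empAvg_sq_eq, mul_pow ‖κ • p.2.1 + b • p.2.2‖, h3, ← h2]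
  ring

theorem EmpiricalLawTendsto.tendsto_add_noise_lipschitz (hd : Tendsto d atTop atTop)
    (h : EmpiricalLawTendsto d ν μ) (κ b : ℝ) {K : NNReal} {B : ℝ} {ψ : ℝ → ℝ}
    (hψ : LipschitzWith K ψ) (hB : ∀ y, |ψ y| ≤ B) :
    Tendsto (fun p : Σ N, EuclideanSpace ℝ (Fin (d N)) × EuclideanSpace ℝ (Fin (d N)) =>
      empAvg ψ (κ • p.2.1 + b • p.2.2).ofLp)
      (probFilter fun N => (ν N).prod (stdGaussian (EuclideanSpace ℝ (Fin (d N)))))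
      (𝓝 (∫ x, ψ x ∂((μ.prod (gaussianReal 0 1)).map fun p => κ * p.1 + b * p.2))) := by
  have h1 := tendsto_empAvg_add_noise (ν := ν) hd κ b hψ hB
  have h2 := (h _ (lipschitzWith_integral_gaussian κ b hψ hB).isPseudoLipschitz_two).comp
    (tendsto_probFilter_measurePreserving fun N =>
      measurePreserving_fst (μ := ν N) (ν := stdGaussian (EuclideanSpace ℝ (Fin (d N)))))
  simp only [Function.comp_def] at h2
  rw [integral_map_add_gaussian κ b hψ hB]
  simpa using h1.add h2

end AddNoise

theorem integrable_sq_map_add_gaussian {μ : Measure ℝ} [IsProbabilityMeasure μ]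
    (hμ : Integrable (fun x => x ^ 2) μ) (κ b : ℝ) :
    Integrable (fun x => x ^ 2)
      ((μ.prod (gaussianReal 0 1)).map fun p => κ * p.1 + b * p.2) :=
  (integrable_map_measure (by fun_prop) (by fun_prop)).2 (integrable_prod_gaussian_sq κ b hμ)

/-- The independent randomness of the decoupled step: the components `g` of the rows along the
current iterate, and the Gaussian vector `ξ`. -/
noncomputable def freshLaw (n d : ℕ) :
    Measure ((Fin n → ℝ) × EuclideanSpace ℝ (Fin d)) :=
  (Measure.pi fun _ : Fin n => gaussianReal 0 1).prod (stdGaussian (EuclideanSpace ℝ (Fin d)))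

instance (n d : ℕ) : IsProbabilityMeasure (freshLaw n d) := by
  unfold freshLaw; infer_instance

theorem measurePreserving_fst_freshLaw (n d : ℕ) :
    MeasurePreserving Prod.fst (freshLaw n d) (Measure.pi fun _ : Fin n => gaussianReal 0 1) :=
  measurePreserving_fst

theorem measurePreserving_snd_freshLaw (n d : ℕ) :
    MeasurePreserving Prod.snd (freshLaw n d) (stdGaussian (EuclideanSpace ℝ (Fin d))) :=
  measurePreserving_snd

theorem stepLaw_eq {n d : ℕ} {φ : ℝ → ℝ} (hφ : Measurable φ) (γ : ℝ)
    (ν : Measure (EuclideanSpace ℝ (Fin d))) :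
    stepLaw n φ γ ν = (ν.prod (freshLaw n d)).map
      (fun p => decoupledStep φ (-γ * (√(d : ℝ))⁻¹) (√(d : ℝ))⁻¹ p.1 p.2.1 p.2.2) :=
  map_prod_eq_of_fiberwise _ _ _ (measurable_rowStep hφ _ _)
    (measurable_decoupledStep hφ _ _) fun w => map_rowStep hφ _ _ w

/-- One gradient step with fresh Gaussian data propagates the convergence of empirical
distributions, and the limit evolves by the scalar recursion. -/
theorem EmpiricalLawTendsto.step {n d : ℕ → ℕ} {α : ℝ} (hα : 0 < α)
    (hd : Tendsto d atTop atTop) (hnd : Tendsto (fun N => (n N : ℝ) / (d N : ℝ)) atTop (𝓝 α))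
    {φ : ℝ → ℝ} (hφ : Differentiable ℝ φ) {L : ℝ} {q : ℕ} (hL : 0 ≤ L)
    (hφL : ∀ x y, |φ x - φ y| ≤ L * (1 + |x| ^ q + |y| ^ q) * |x - y|) (γ : ℝ)
    {ν : ∀ N, Measure (EuclideanSpace ℝ (Fin (d N)))} [∀ N, IsProbabilityMeasure (ν N)]
    {μ : Measure ℝ} [IsProbabilityMeasure μ] (hμ : Integrable (fun x => x ^ 2) μ)
    (h : EmpiricalLawTendsto d ν μ) :
    EmpiricalLawTendsto d (fun N => stepLaw (n N) φ γ (ν N))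
      ((μ.prod (gaussianReal 0 1)).map fun p =>
        (1 - γ * α * ∫ x, deriv φ (√(∫ x, x ^ 2 ∂μ) * x) ∂(gaussianReal 0 1)) * p.1 +
          (-γ * √(α * ∫ x, φ (√(∫ x, x ^ 2 ∂μ) * x) ^ 2 ∂(gaussianReal 0 1))) * p.2) := by
  have hφm : Measurable φ := hφ.continuous.measurable
  have hn := tendsto_atTop_of_ratio hα hd hnd
  have hFw := tendsto_probFilter_measurePreserving fun N =>
    measurePreserving_fst (μ := ν N) (ν := freshLaw (n N) (d N))
  have hFg := tendsto_probFilter_measurePreserving fun N =>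
    (measurePreserving_fst_freshLaw (n N) (d N)).comp
      (measurePreserving_snd (μ := ν N) (ν := freshLaw (n N) (d N)))
  have hFwξ := tendsto_probFilter_measurePreserving fun N =>
    (MeasurePreserving.id (ν N)).prod (measurePreserving_snd_freshLaw (n N) (d N))
  have hFξ := tendsto_probFilter_measurePreserving fun N =>
    (measurePreserving_snd_freshLaw (n N) (d N)).comp
      (measurePreserving_snd (μ := ν N) (ν := freshLaw (n N) (d N)))
  have hw := (tendsto_norm_of_empAvg_sq
    (d := fun p : Σ N, EuclideanSpace ℝ (Fin (d N)) => d p.1)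
    (x := fun p => p.2) (h _ isPseudoLipschitz_two_sq)).comp hFw
  have hξ := (tendsto_norm_stdGaussian hd).comp hFξ
  have hwξ := (tendsto_inner_direction_stdGaussian (ν := ν) hd).comp hFwξ
  simp only [Function.comp_def] at hw hξ hwξ
  have hclose := tendsto_decoupledStep_sub hn hnd hφ hL hφL γ _ tendsto_fst_probFilter
    hw hFg hξ hwξ
  set κ := 1 - γ * α * ∫ x, deriv φ (√(∫ x, x ^ 2 ∂μ) * x) ∂(gaussianReal 0 1) with hκ
  set b := -γ * √(α * ∫ x, φ (√(∫ x, x ^ 2 ∂μ) * x) ^ 2 ∂(gaussianReal 0 1)) with hb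
  have : IsProbabilityMeasure ((μ.prod (gaussianReal 0 1)).map fun p => κ * p.1 + b * p.2) :=
    Measure.isProbabilityMeasure_map (by fun_prop)
  have hsq := (h.tendsto_add_noise_sq hd hμ κ b).comp hFwξ
  have hsq' := tendsto_empAvg_sq_of_close hclose (integral_nonneg fun x => sq_nonneg x) hsq
  have hbl := fun (K : NNReal) (B : ℝ) (ψ : ℝ → ℝ) (hψ : LipschitzWith K ψ)
      (hB : ∀ y, |ψ y| ≤ B) => (h.tendsto_add_noise_lipschitz hd κ b hψ hB).comp hFwξ
  simp only [Function.comp_def] at hbl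
  have hbl' := fun (K : NNReal) (B : ℝ) (ψ : ℝ → ℝ) (hψ : LipschitzWith K ψ)
      (hB : ∀ y, |ψ y| ≤ B) => tendsto_empAvg_of_close hclose hψ (hbl K B ψ hψ hB)
  intro ψ hψ
  have hlim := tendsto_empAvg_of_bounded_lipschitz (integrable_sq_map_add_gaussian hμ κ b)
    hsq' hbl' hψ
  have hX : ∀ N, Measurable fun x : EuclideanSpace ℝ (Fin (d N)) => empAvg ψ x.ofLp := fun N =>
    (Finset.measurable_sum _ fun i _ =>
      hψ.continuous.measurable.comp (by fun_prop)).const_mul _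
  simp_rw [stepLaw_eq hφm]
  exact (tendsto_probFilter_map_iff
    (fun N => (measurable_decoupledStep hφm _ _).aemeasurable) hX).2 hlim

/-! ### The gradient of a separable loss and the gradient step -/

theorem gradient_separableLoss {f : ℝ → ℝ} (hf : Differentiable ℝ f) (n : ℕ)
    (x : EuclideanSpace ℝ (Fin n)) :
    gradient (separableLoss f n) x = WithLp.toLp 2 fun i => deriv f (x i) := by
  refine HasGradientAt.gradient (hasGradientAt_iff_hasFDerivAt.2 ?_)
  have hproj : ∀ i, HasFDerivAt (fun x : EuclideanSpace ℝ (Fin n) => x i)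
      (EuclideanSpace.proj i : EuclideanSpace ℝ (Fin n) →L[ℝ] ℝ) x := fun i =>
    (EuclideanSpace.proj i : EuclideanSpace ℝ (Fin n) →L[ℝ] ℝ).hasFDerivAt
  have h : HasFDerivAt (fun x : EuclideanSpace ℝ (Fin n) => ∑ i, f (x i))
      (∑ i, deriv f (x i) • (EuclideanSpace.proj i : EuclideanSpace ℝ (Fin n) →L[ℝ] ℝ)) x :=
    HasFDerivAt.fun_sum fun i _ =>
      (hf (x i)).hasDerivAt.comp_hasFDerivAt x (hproj i)
  have e : (InnerProductSpace.toDual ℝ (EuclideanSpace ℝ (Fin n)))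
      (WithLp.toLp 2 fun i => deriv f (x i)) =
      ∑ i, deriv f (x i) • (EuclideanSpace.proj i : EuclideanSpace ℝ (Fin n) →L[ℝ] ℝ) := by
    ext v
    simp [PiLp.inner_apply, mul_comm]
  rw [e]
  exact h

/-- In dimension `1` the gradient is `f'`, so the hypothesis there already controls `f'`. -/
theorem exists_growth_of_gradient_one {f : ℝ → ℝ} (hf : Differentiable ℝ f) {k : ℕ}
    (h : IsPseudoLipschitz k (gradient (separableLoss f 1))) :
    ∃ L : ℝ, 0 ≤ L ∧ ∀ x y, |deriv f x - deriv f y| ≤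
      L * (1 + |x| ^ (k - 1) + |y| ^ (k - 1)) * |x - y| := by
  obtain ⟨L, hL⟩ := h
  refine ⟨|L|, abs_nonneg L, fun x y => ?_⟩
  have h1 := hL (WithLp.toLp 2 fun _ => x) (WithLp.toLp 2 fun _ => y)
  rw [gradient_separableLoss hf, gradient_separableLoss hf] at h1
  simp only [← WithLp.toLp_sub, EuclideanSpace.norm_eq] at h1
  simp [Real.sqrt_sq_eq_abs] at h1
  refine h1.trans ?_
  have := le_abs_self L
  gcongr

/-- The rows of a matrix, scaled so that entries of variance `1 / d` become entries of
variance `1`. -/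
noncomputable def scaledRows {n d : ℕ} (A : Matrix (Fin n) (Fin d) ℝ) (j : Fin n) :
    EuclideanSpace ℝ (Fin d) :=
  WithLp.toLp 2 fun i => √(d : ℝ) * A j i

/-- Gradient descent in terms of rows of unit variance; the scale of the rows is compensated by the
two factors `1 / √d`. -/
theorem gdIterate_succ {f : ℝ → ℝ} (hf : Differentiable ℝ f) {n d : ℕ} (γ : ℕ → ℝ)
    (A : ℕ → Matrix (Fin n) (Fin d) ℝ) (w₀ : EuclideanSpace ℝ (Fin d)) (t : ℕ) :
    gdIterate (separableLoss f n) γ A w₀ (t + 1) =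
      rowStep (deriv f) (-γ t * (√(d : ℝ))⁻¹) (√(d : ℝ))⁻¹
        (gdIterate (separableLoss f n) γ A w₀ t) (scaledRows (A t)) := by
  rw [gdIterate, gradient_separableLoss hf, rowStep]
  set w := gdIterate (separableLoss f n) γ A w₀ t
  ext i
  have hd : √(d : ℝ) ≠ 0 := by
    have := i.pos
    positivity
  have h1 : ∀ j, ⟪scaledRows (A t) j, w⟫ * (√(d : ℝ))⁻¹ = ∑ i, A t j i * w i := by
    intro j
    rw [PiLp.inner_apply, Finset.sum_mul]
    refine Finset.sum_congr rfl fun i _ => ?_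
    simp only [scaledRows, RCLike.inner_apply, conj_trivial]
    field_simp
  simp only [h1]
  simp only [Matrix.toLpLin_apply, PiLp.sub_apply, PiLp.smul_apply, PiLp.add_apply,
    WithLp.ofLp_sum, Finset.sum_apply, WithLp.ofLp_smul, Pi.smul_apply, smul_eq_mul,
    Matrix.mulVec, dotProduct, Matrix.transpose_apply, scaledRows]
  rw [sub_eq_add_neg, Finset.mul_sum, Finset.mul_sum, ← Finset.sum_neg_distrib]
  congr 1
  refine Finset.sum_congr rfl fun j _ => ?_
  field_simp

/-- The iterate number `t` depends on the matrices before time `t` only. -/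
theorem gdIterate_congr {n d : ℕ} {F : EuclideanSpace ℝ (Fin n) → ℝ} {γ : ℕ → ℝ}
    {A A' : ℕ → Matrix (Fin n) (Fin d) ℝ} {w₀ : EuclideanSpace ℝ (Fin d)} {t : ℕ}
    (h : ∀ r < t, A r = A' r) : gdIterate F γ A w₀ t = gdIterate F γ A' w₀ t := by
  induction t with
  | zero => rfl
  | succ t ih => rw [gdIterate, gdIterate, ih fun r hr => h r (hr.trans t.lt_succ_self),
      h t t.lt_succ_self]

/-! ### Laws of the iterates -/

section Iterates

variable {n d : ℕ}

/-- The initial vector contained in a family of initial and matrix entries. -/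
noncomputable def dataInit (x : Fin d ⊕ (ℕ × Fin n × Fin d) → ℝ) : EuclideanSpace ℝ (Fin d) :=
  WithLp.toLp 2 fun i => x (Sum.inl i)

/-- The data matrices contained in a family of initial and matrix entries. -/
def dataMatrix (x : Fin d ⊕ (ℕ × Fin n × Fin d) → ℝ) (r : ℕ) : Matrix (Fin n) (Fin d) ℝ :=
  fun j i => x (Sum.inr (r, j, i))

theorem measurable_gdIterate {f : ℝ → ℝ} (hf : Differentiable ℝ f) (γ : ℕ → ℝ) (t : ℕ) :
    Measurable fun x : Fin d ⊕ (ℕ × Fin n × Fin d) → ℝ =>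
      gdIterate (separableLoss f n) γ (dataMatrix x) (dataInit x) t := by
  induction t with
  | zero =>
    show Measurable fun x : Fin d ⊕ (ℕ × Fin n × Fin d) → ℝ => dataInit x
    unfold dataInit
    fun_prop
  | succ t ih =>
    simp_rw [gdIterate_succ hf]
    refine (measurable_rowStep (measurable_deriv f) _ _).comp (ih.prodMk ?_)
    unfold dataMatrix
    fun_prop

/-- The entries which determine the iterate number `t`. -/
def pastIndices (n d t : ℕ) : Finset (Fin d ⊕ (ℕ × Fin n × Fin d)) :=
  Finset.univ.disjSum (Finset.range t ×ˢ Finset.univ)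

/-- The entries of the data matrix number `t`. -/
def presentIndices (n d t : ℕ) : Finset (Fin d ⊕ (ℕ × Fin n × Fin d)) :=
  (∅ : Finset (Fin d)).disjSum ({t} ×ˢ Finset.univ)

theorem disjoint_pastIndices (n d t : ℕ) :
    Disjoint (pastIndices n d t) (presentIndices n d t) := by
  rw [Finset.disjoint_left]
  rintro (i | ⟨r, j, i⟩) h1 h2
  · simp [presentIndices] at h2
  · simp [pastIndices, presentIndices] at h1 h2
    omega

/-- Extension by zero. -/
def extendZero {ι : Type*} [DecidableEq ι] (S : Finset ι) (v : S → ℝ) (i : ι) : ℝ :=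
  if h : i ∈ S then v ⟨i, h⟩ else 0

theorem measurable_extendZero {ι : Type*} [DecidableEq ι] (S : Finset ι) :
    Measurable (extendZero S) := by
  refine measurable_pi_lambda _ fun i => ?_
  unfold extendZero
  split_ifs with h <;> fun_prop

variable {Ω : Type*} [MeasurableSpace Ω] {P : Measure Ω}
  {w₀ : Ω → EuclideanSpace ℝ (Fin d)} {A : ℕ → Ω → Matrix (Fin n) (Fin d) ℝ}

theorem aemeasurable_entries (hw₀ : ∀ i, AEMeasurable (fun s => w₀ s i) P)
    (hA : ∀ t i j, AEMeasurable (fun s => A t s i j) P) :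
    ∀ i, AEMeasurable (Sum.elim (fun (i : Fin d) (s : Ω) => w₀ s i)
      (fun (p : ℕ × Fin n × Fin d) (s : Ω) => A p.1 s p.2.1 p.2.2) i) P
  | Sum.inl i => hw₀ i
  | Sum.inr p => hA p.1 p.2.1 p.2.2

theorem aemeasurable_gdIterate {f : ℝ → ℝ} (hf : Differentiable ℝ f) (γ : ℕ → ℝ)
    (hw₀ : ∀ i, AEMeasurable (fun s => w₀ s i) P)
    (hA : ∀ t i j, AEMeasurable (fun s => A t s i j) P) (t : ℕ) :
    AEMeasurable (fun s => gdIterate (separableLoss f n) γ (fun r => A r s) (w₀ s) t) P :=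
  (measurable_gdIterate hf γ t).comp_aemeasurable
    (aemeasurable_pi_iff.2 (aemeasurable_entries hw₀ hA))

/-- Sample splitting: the iterate number `t` is independent of the data matrix number `t`. -/
theorem indepFun_gdIterate_scaledRows {f : ℝ → ℝ} (hf : Differentiable ℝ f) (γ : ℕ → ℝ)
    (hw₀ : ∀ i, AEMeasurable (fun s => w₀ s i) P)
    (hA : ∀ t i j, AEMeasurable (fun s => A t s i j) P)
    (hindep : iIndepFun
      (Sum.elim (fun (i : Fin d) (s : Ω) => w₀ s i)
        (fun (p : ℕ × Fin n × Fin d) (s : Ω) => A p.1 s p.2.1 p.2.2)) P) (t : ℕ) :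
    IndepFun (fun s => gdIterate (separableLoss f n) γ (fun r => A r s) (w₀ s) t)
      (fun s => scaledRows (A t s)) P := by
  have h := hindep.indepFun_finset₀ _ _ (disjoint_pastIndices n d t)
    (aemeasurable_entries hw₀ hA)
  have h1 : Measurable fun v : pastIndices n d t → ℝ =>
      gdIterate (separableLoss f n) γ (dataMatrix (extendZero _ v)) (dataInit (extendZero _ v)) t :=
    (measurable_gdIterate hf γ t).comp (measurable_extendZero _)
  have h2 : Measurable fun v : presentIndices n d t → ℝ =>
      scaledRows (dataMatrix (extendZero _ v) t) := by
    have := measurable_extendZero (presentIndices n d t)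
    unfold scaledRows dataMatrix
    fun_prop
  convert h.comp h1 h2 using 1
  · funext s
    have e : dataInit (extendZero (pastIndices n d t) fun i =>
        Sum.elim (fun (i : Fin d) (s : Ω) => w₀ s i)
          (fun (p : ℕ × Fin n × Fin d) (s : Ω) => A p.1 s p.2.1 p.2.2) i s) = w₀ s := by
      ext i
      simp [dataInit, extendZero, pastIndices]
    simp only [Function.comp, e]
    refine gdIterate_congr fun r hr => ?_
    ext j i
    simp [dataMatrix, extendZero, pastIndices, hr]
  · funext s j
    simp only [Function.comp, scaledRows]
    congr 1
    funext i
    simp [dataMatrix, extendZero, presentIndices]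

theorem map_curry_pi {ι κ : Type*} [Fintype ι] [Fintype κ] (μ : Measure ℝ)
    [IsProbabilityMeasure μ] :
    (Measure.pi fun _ : ι × κ => μ).map Function.curry =
      Measure.pi fun _ : ι => Measure.pi fun _ : κ => μ := by
  have h := Measure.infinitePi_map_curry (ι := ι) (κ := κ) (X := ℝ) (fun _ _ => μ)
  simp only [Measure.infinitePi_eq_pi] at h
  exact h

theorem hasLaw_scaledRows {t : ℕ}
    (hA : ∀ i j, HasLaw (fun s => A t s i j) (gaussianReal 0 (1 / (d : NNReal))) P)
    (hindep : iIndepFun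
      (Sum.elim (fun (i : Fin d) (s : Ω) => w₀ s i)
        (fun (p : ℕ × Fin n × Fin d) (s : Ω) => A p.1 s p.2.1 p.2.2)) P) :
    HasLaw (fun s => scaledRows (A t s))
      (Measure.pi fun _ : Fin n => stdGaussian (EuclideanSpace ℝ (Fin d))) P := by
  have h1 : iIndepFun (fun (p : Fin n × Fin d) s => √(d : ℝ) * A t s p.1 p.2) P := by
    have := hindep.precomp (g := fun p : Fin n × Fin d => Sum.inr (t, p))
      (fun p p' h => by simpa using h)
    exact this.comp (fun _ x => √(d : ℝ) * x) (fun _ => by fun_prop)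
  have h2 : ∀ p : Fin n × Fin d,
      HasLaw (fun s => √(d : ℝ) * A t s p.1 p.2) (gaussianReal 0 1) P := by
    intro p
    have hd : (d : ℝ) ≠ 0 := by have := p.2.pos; positivity
    refine HasLaw.fun_comp (X := fun s => A t s p.1 p.2) (Y := fun x => √(d : ℝ) * x) ?_
      (hA p.1 p.2)
    refine ⟨by fun_prop, ?_⟩
    rw [gaussianReal_map_const_mul, mul_zero]
    congr 1
    ext
    simp [Real.sq_sqrt, hd]
  have h3 := iIndepFun.hasLaw_pi h2 h1
  have h4 : Measurable fun (x : Fin n × Fin d → ℝ) (j : Fin n) =>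
      (WithLp.toLp 2 (Function.curry x j) : EuclideanSpace ℝ (Fin d)) := by
    unfold Function.curry
    fun_prop
  refine HasLaw.fun_comp (Y := fun (x : Fin n × Fin d → ℝ) (j : Fin n) =>
    (WithLp.toLp 2 (Function.curry x j) : EuclideanSpace ℝ (Fin d))) ⟨h4.aemeasurable, ?_⟩ h3
  have h5 : ∀ _ : Fin n, IsProbabilityMeasure ((Measure.pi fun _ : Fin d => gaussianReal 0 1).map
      (WithLp.toLp 2)) := fun _ => Measure.isProbabilityMeasure_map (by fun_prop)
  have h6 := Measure.pi_map_pi (μ := fun _ : Fin n => Measure.pi fun _ : Fin d => gaussianReal 0 1)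
    (f := fun _ => WithLp.toLp 2) (fun _ => by fun_prop)
  simp only [map_pi_eq_stdGaussian] at h6
  rw [← h6, ← map_curry_pi, Measure.map_map (by fun_prop)]
  · rfl
  · unfold Function.curry
    fun_prop

theorem map_gdIterate_succ [IsProbabilityMeasure P] {f : ℝ → ℝ} (hf : Differentiable ℝ f)
    (γ : ℕ → ℝ)
    (hw₀ : ∀ i, AEMeasurable (fun s => w₀ s i) P)
    (hA : ∀ t i j, HasLaw (fun s => A t s i j) (gaussianReal 0 (1 / (d : NNReal))) P)
    (hindep : iIndepFun
      (Sum.elim (fun (i : Fin d) (s : Ω) => w₀ s i)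
        (fun (p : ℕ × Fin n × Fin d) (s : Ω) => A p.1 s p.2.1 p.2.2)) P) (t : ℕ) :
    P.map (fun s => gdIterate (separableLoss f n) γ (fun r => A r s) (w₀ s) (t + 1)) =
      stepLaw n (deriv f) (γ t)
        (P.map fun s => gdIterate (separableLoss f n) γ (fun r => A r s) (w₀ s) t) := by
  have hAm : ∀ t i j, AEMeasurable (fun s => A t s i j) P := fun t i j => (hA t i j).aemeasurable
  have h1 : HasLaw (fun s => gdIterate (separableLoss f n) γ (fun r => A r s) (w₀ s) t)
      (P.map fun s => gdIterate (separableLoss f n) γ (fun r => A r s) (w₀ s) t) P :=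
    ⟨aemeasurable_gdIterate hf γ hw₀ hAm t, rfl⟩
  have h2 := (indepFun_gdIterate_scaledRows hf γ hw₀ hAm hindep t).hasLaw_prod h1
    (hasLaw_scaledRows (hA t) hindep)
  rw [stepLaw, ← h2.map_eq, AEMeasurable.map_map_of_aemeasurable
    (measurable_rowStep (measurable_deriv f) _ _).aemeasurable h2.aemeasurable]
  congr 1
  funext s
  exact gdIterate_succ hf γ _ _ t

end Iterates

/-! ### The scalar process -/

section Scalar

variable {Ω : Type*} [MeasurableSpace Ω] {Q : Measure Ω}

theorem IsSubgaussian.integrable_pow_four {X : Ω → ℝ} (hX : AEMeasurable X Q)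
    (h : IsSubgaussian X Q) : Integrable (fun s => X s ^ 4) Q := by
  obtain ⟨K, hK, hle⟩ := h
  have hexp : Integrable (fun s => Real.exp (X s ^ 2 / K ^ 2)) Q := by
    refine ⟨(Real.measurable_exp.comp_aemeasurable
      ((hX.pow_const 2).div_const _)).aestronglyMeasurable, ?_⟩
    rw [hasFiniteIntegral_iff_ofReal (ae_of_all _ fun s => (Real.exp_pos _).le)]
    exact hle.trans_lt ENNReal.ofNat_lt_top
  refine Integrable.mono' (hexp.const_mul (2 * K ^ 4)) (hX.pow_const 4).aestronglyMeasurable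
    (ae_of_all _ fun s => ?_)
  rw [Real.norm_eq_abs, abs_of_nonneg (by positivity)]
  have h1 := Real.quadratic_le_exp_of_nonneg (by positivity : 0 ≤ X s ^ 2 / K ^ 2)
  have h2 : X s ^ 4 = 2 * K ^ 4 * ((X s ^ 2 / K ^ 2) ^ 2 / 2) := by field_simp
  have h3 : 0 ≤ X s ^ 2 / K ^ 2 := by positivity
  rw [h2]
  gcongr
  linarith

theorem IsPseudoLipschitz.memLp_two {ψ : ℝ → ℝ} (h : IsPseudoLipschitz 2 ψ) {μ : Measure ℝ}
    [IsFiniteMeasure μ] (hμ : Integrable (fun x => x ^ 4) μ) : MemLp ψ 2 μ := by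
  obtain ⟨L, hL0, hL⟩ := h.exists_nonneg
  have h2 : MemLp (fun x : ℝ => x ^ 2) 2 μ :=
    (memLp_two_iff_integrable_sq (by fun_prop)).2 (hμ.congr (ae_of_all _ fun x => by ring))
  have h1 : MemLp (fun x : ℝ => 1 + x ^ 2) 2 μ := (memLp_const (1 : ℝ)).add h2
  have h3 : MemLp (fun x : ℝ => |ψ 0| + 2 * L * (1 + x ^ 2)) 2 μ :=
    (memLp_const |ψ 0|).add (h1.const_mul (2 * L))
  exact h3.mono' h.continuous.aestronglyMeasurable
    (ae_of_all _ fun x => isPseudoLipschitz_two_bound hL0 hL x)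

theorem integral_gaussianReal_eq_scale {φ : ℝ → ℝ} (hφ : Measurable φ) {ρ : ℝ} (hρ : 0 ≤ ρ) :
    ∫ x, φ x ∂(gaussianReal 0 ρ.toNNReal) = ∫ x, φ (√ρ * x) ∂(gaussianReal 0 1) := by
  rw [← integral_map (φ := fun x => √ρ * x) (by fun_prop) hφ.aestronglyMeasurable,
    gaussianReal_map_const_mul, mul_zero]
  congr 2
  ext
  simp [Real.sq_sqrt hρ, hρ]

/-- One step of the scalar process: it preserves square integrability, and the law of the next
variable is that of a linear combination of the current one and an independent standard Gaussian.
The symmetry of the Gaussian law allows the sign of the noise to be reversed. -/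
theorem IsScalarProcess.step_law [IsProbabilityMeasure Q] {f : ℝ → ℝ}
    (hf' : Differentiable ℝ (deriv f)) {α : ℝ} (hα : 0 < α) {γ : ℕ → ℝ} {ω z u : ℕ → Ω → ℝ}
    (h : IsScalarProcess Q f α γ ω z u) {t : ℕ} (hω : MemLp (ω t) 2 Q) :
    MemLp (ω (t + 1)) 2 Q ∧
      Q.map (ω (t + 1)) = ((Q.map (ω t)).prod (gaussianReal 0 1)).map fun p =>
        (1 - γ t * α * ∫ x, deriv (deriv f) (√(∫ x, x ^ 2 ∂(Q.map (ω t))) * x)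
          ∂(gaussianReal 0 1)) * p.1 +
          (-γ t * √(α * ∫ x, deriv f (√(∫ x, x ^ 2 ∂(Q.map (ω t))) * x) ^ 2
            ∂(gaussianReal 0 1))) * p.2 := by
  have hm1 : Measurable (deriv f) := hf'.continuous.measurable
  have hm2 : Measurable (deriv (deriv f)) := measurable_deriv _
  have hωm := hω.aestronglyMeasurable.aemeasurable
  have hum := (h.law_u t).aemeasurable
  have hρ : ∫ x, x ^ 2 ∂(Q.map (ω t)) = ∫ s, ω t s ^ 2 ∂Q := integral_map hωm (by fun_prop)
  have hρ0 : 0 ≤ ∫ s, ω t s ^ 2 ∂Q := integral_nonneg fun s => sq_nonneg _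
  have e1 : ∫ s, deriv (deriv f) (z t s) ∂Q =
      ∫ x, deriv (deriv f) (√(∫ x, x ^ 2 ∂(Q.map (ω t))) * x) ∂(gaussianReal 0 1) := by
    rw [hρ, ← integral_gaussianReal_eq_scale hm2 hρ0]
    exact (h.law_z t).integral_comp hm2.aestronglyMeasurable
  have e2 : ∫ s, deriv f (z t s) ^ 2 ∂Q =
      ∫ x, deriv f (√(∫ x, x ^ 2 ∂(Q.map (ω t))) * x) ^ 2 ∂(gaussianReal 0 1) := by
    rw [hρ, ← integral_gaussianReal_eq_scale (φ := fun x => deriv f x ^ 2) (hm1.pow_const 2) hρ0]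
    exact (h.law_z t).integral_comp (f := fun x => deriv f x ^ 2)
      (hm1.pow_const 2).aestronglyMeasurable
  rw [← e1, ← e2]
  set κ := 1 - γ t * α * ∫ s, deriv (deriv f) (z t s) ∂Q with hκ
  set τ := α * ∫ s, deriv f (z t s) ^ 2 ∂Q with hτ
  have hτ0 : 0 ≤ τ := mul_nonneg hα.le (integral_nonneg fun s => sq_nonneg _)
  have hstep : ω (t + 1) = fun s => κ * ω t s + γ t * u t s := funext fun s => h.step t s
  have hu2 : MemLp (u t) 2 Q := by
    have := memLp_id_gaussianReal (μ := 0) (v := τ.toNNReal) 2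
    rw [← (h.law_u t).map_eq, memLp_map_measure_iff (by fun_prop) hum] at this
    exact this
  refine ⟨?_, ?_⟩
  · rw [hstep]
    exact (hω.const_mul κ).add (hu2.const_mul (γ t))
  have hscale : gaussianReal 0 τ.toNNReal = (gaussianReal 0 1).map (fun x => -√τ * x) := by
    rw [gaussianReal_map_const_mul, mul_zero]
    congr 1
    ext
    simp [Real.sq_sqrt hτ0, hτ0]
  have hjoint := (h.indep t).hasLaw_prod ⟨hωm, rfl⟩ (h.law_u t)
  have hprob : IsProbabilityMeasure (Q.map (ω t)) := Measure.isProbabilityMeasure_map hωm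
  have hlaw : Q.map (ω (t + 1)) =
      ((Q.map (ω t)).prod (gaussianReal 0 τ.toNNReal)).map (fun p => κ * p.1 + γ t * p.2) := by
    rw [← hjoint.map_eq, AEMeasurable.map_map_of_aemeasurable (by fun_prop) hjoint.aemeasurable,
      hstep]
    rfl
  rw [hlaw]
  refine map_prod_eq_of_fiberwise _ _ _ (by fun_prop) (by fun_prop) fun x => ?_
  rw [hscale, Measure.map_map (by fun_prop) (by fun_prop)]
  congr 1
  funext y
  simp only [Function.comp]
  ring

end Scalar

/-- The law of large numbers for the initialization. The fourth moment makes test functions of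
quadratic growth square integrable. -/
theorem empiricalLawTendsto_pi {d : ℕ → ℕ} (hd : Tendsto d atTop atTop) {μ : Measure ℝ}
    [IsProbabilityMeasure μ] (hμ : Integrable (fun x => x ^ 4) μ) :
    EmpiricalLawTendsto d
      (fun N => (Measure.pi fun _ : Fin (d N) => μ).map (WithLp.toLp 2)) μ := by
  intro ψ hψ
  refine (tendsto_probFilter_map_iff (P := fun N => Measure.pi fun _ : Fin (d N) => μ)
    (X := fun N (x : EuclideanSpace ℝ (Fin (d N))) => empAvg ψ x.ofLp)
    (fun N => by fun_prop) (fun N => ?_)).2 (tendsto_empAvg_pi hd (hψ.memLp_two hμ))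
  exact (Finset.measurable_sum _ fun i _ =>
    hψ.continuous.measurable.comp (by fun_prop)).const_mul _

theorem mainTheorem3
    -- the loss: twice differentiable, separable, with pseudo-Lipschitz gradient
    (f : ℝ → ℝ) (hf : Differentiable ℝ f) (hf' : Differentiable ℝ (deriv f))
    (k : ℕ) (hk : 1 ≤ k)
    (hgrad : ∀ n : ℕ, 1 ≤ n → IsPseudoLipschitz k (gradient (separableLoss f n)))
    -- step sizes and proportional asymptotics
    (γ : ℕ → ℝ) (α : ℝ) (hα : 0 < α) (n d : ℕ → ℕ)
    (hd : Tendsto d atTop atTop)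
    (hnd : Tendsto (fun N => (n N : ℝ) / (d N : ℝ)) atTop (𝓝 α))
    -- the scalar process
    {Ω' : Type*} [MeasurableSpace Ω'] (Q : Measure Ω') [IsProbabilityMeasure Q]
    (ω z u : ℕ → Ω' → ℝ) (hω₀ : IsSubgaussian (ω 0) Q)
    (hω : IsScalarProcess Q f α γ ω z u)
    -- the initialization and the data matrices: all entries jointly independent
    {Ω : ℕ → Type*} [∀ N, MeasurableSpace (Ω N)]
    (P : ∀ N, Measure (Ω N)) [∀ N, IsProbabilityMeasure (P N)]
    (w₀ : ∀ N, Ω N → EuclideanSpace ℝ (Fin (d N)))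
    (A : ∀ N, ℕ → Ω N → Matrix (Fin (n N)) (Fin (d N)) ℝ)
    (hw₀ : ∀ N i, IdentDistrib (fun s => w₀ N s i) (ω 0) (P N) Q)
    (hA : ∀ N t i j, HasLaw (fun s => A N t s i j) (gaussianReal 0 (1 / (d N : NNReal))) (P N))
    (hindep : ∀ N, iIndepFun
      (Sum.elim (fun (i : Fin (d N)) (s : Ω N) => w₀ N s i)
        (fun (p : ℕ × Fin (n N) × Fin (d N)) (s : Ω N) => A N p.1 s p.2.1 p.2.2)) (P N))
    (t : ℕ) (ψ : ℝ → ℝ) (hψ : IsPseudoLipschitz 2 ψ) :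
    Integrable (fun s => ψ (ω t s)) Q ∧
    TendstoInProbability P
      (fun N s => 1 / (d N : ℝ) *
        ∑ i, ψ (gdIterate (separableLoss f (n N)) γ (fun r => A N r s) (w₀ N s) t i))
      (∫ s, ψ (ω t s) ∂Q) := by
  obtain ⟨L, hL, hφL⟩ := exists_growth_of_gradient_one hf (hgrad 1 le_rfl)
  have hw₀m : ∀ N i, AEMeasurable (fun s => w₀ N s i) (P N) := fun N i =>
    (hw₀ N i).aemeasurable_fst
  have hAm : ∀ N t i j, AEMeasurable (fun s => A N t s i j) (P N) := fun N t i j =>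
    (hA N t i j).aemeasurable
  -- measurability of `ω 0` comes from the identity in distribution with an entry of `w₀`
  obtain ⟨N₀, hN₀⟩ := (hd.eventually_ge_atTop 1).exists
  have hω₀m : AEMeasurable (ω 0) Q := (hw₀ N₀ ⟨0, hN₀⟩).aemeasurable_snd
  have hω₀4 := hω₀.integrable_pow_four hω₀m
  have hω₀2 : MemLp (ω 0) 2 Q := by
    rw [memLp_two_iff_integrable_sq hω₀m.aestronglyMeasurable]
    have h4 : MemLp (fun s => ω 0 s ^ 2) 2 Q :=
      (memLp_two_iff_integrable_sq (hω₀m.pow_const 2).aestronglyMeasurable).2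
        (hω₀4.congr (ae_of_all _ fun s => by ring))
    exact h4.integrable one_le_two
  have hiter : ∀ N t, AEMeasurable
      (fun s => gdIterate (separableLoss f (n N)) γ (fun r => A N r s) (w₀ N s) t) (P N) :=
    fun N t => aemeasurable_gdIterate hf γ (hw₀m N) (hAm N) t
  have hsq : ∀ {t}, MemLp (ω t) 2 Q → Integrable (fun x => x ^ 2) (Q.map (ω t)) := fun h =>
    (integrable_map_measure (by fun_prop) h.aestronglyMeasurable.aemeasurable).2 h.integrable_sq
  have main : ∀ t, MemLp (ω t) 2 Q ∧ EmpiricalLawTendsto d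
      (fun N => (P N).map fun s =>
        gdIterate (separableLoss f (n N)) γ (fun r => A N r s) (w₀ N s) t) (Q.map (ω t)) := by
    intro t
    induction t with
    | zero =>
      refine ⟨hω₀2, ?_⟩
      have hp : IsProbabilityMeasure (Q.map (ω 0)) := Measure.isProbabilityMeasure_map hω₀m
      have h4 : Integrable (fun x => x ^ 4) (Q.map (ω 0)) :=
        (integrable_map_measure (by fun_prop) hω₀m).2 hω₀4
      have hlaw : ∀ N, (P N).map (w₀ N) =
          (Measure.pi fun _ : Fin (d N) => Q.map (ω 0)).map (WithLp.toLp 2) := by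
        intro N
        have h1 : iIndepFun (fun i s => w₀ N s i) (P N) :=
          (hindep N).precomp (g := Sum.inl) Sum.inl_injective
        have h2 := iIndepFun.hasLaw_pi (μ := fun _ => Q.map (ω 0))
          (fun i => ⟨(hw₀ N i).aemeasurable_fst, (hw₀ N i).map_eq⟩) h1
        rw [← h2.map_eq, AEMeasurable.map_map_of_aemeasurable (by fun_prop) h2.aemeasurable]
        rfl
      have h5 := empiricalLawTendsto_pi hd h4
      simp_rw [← hlaw] at h5
      exact h5
    | succ t ih =>
      obtain ⟨h1, h2⟩ := hω.step_law hf' hα ih.1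
      refine ⟨h1, ?_⟩
      have hp : IsProbabilityMeasure (Q.map (ω t)) :=
        Measure.isProbabilityMeasure_map ih.1.aestronglyMeasurable.aemeasurable
      have hp' := fun N => Measure.isProbabilityMeasure_map (hiter N t)
      rw [h2]
      simp_rw [fun N => map_gdIterate_succ hf γ (hw₀m N) (hA N) (hindep N) t]
      exact ih.2.step hα hd hnd hf' hL hφL (γ t) (hsq ih.1)
  obtain ⟨hωt, hlim⟩ := main t
  have hωm := hωt.aestronglyMeasurable.aemeasurable
  have hp : IsProbabilityMeasure (Q.map (ω t)) := Measure.isProbabilityMeasure_map hωm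
  refine ⟨(integrable_map_measure hψ.continuous.aestronglyMeasurable hωm).1
    (hψ.integrable (hsq hωt)), ?_⟩
  rw [tendstoInProbability_iff, ← integral_map hωm hψ.continuous.aestronglyMeasurable]
  have h := (hlim ψ hψ).comp (tendsto_probFilter_map fun N => hiter N t)
  simp only [Function.comp_def] at h
  exact h
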